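/- **Setting.** Let $n,m,p,B$ be integers with $n\ge 1$, $1\le B\le m$, and put $N:=nm$. Consider $F=\frac1n\sum_{i=1}^n f_i$ on $\mathbb R^p$, where $f_i=\frac1m\sum_{j=1}^m f_{i,j}$ and each $f_{i,j}:\mathbb R^p\to\mathbb R$ is differentiable. Assume that $F^*:=\inf F>-\infty$ and that, for some $L>0$, $$\tfrac1m\sum_{j=1}^m\|\nabla f_{i,j}(x)-\nabla f_{i,j}(y)\|^2\le L^2\|x-y\|^2\qquad\text{for all } i \text{ and all } x,y\in\mathbb R^p .$$ Let $W=(w_{ir})\in\mathbb R^{n\times n}$ be nonnegative, doubly stochastic and primitive with positive diagonal, and let $\lambda:=\|W-\frac1n\mathbf 1\mathbf 1^\top\|$ (spectral norm; then $\lambda\in[0,1)$). **Algorithm (GT-SARAH)** with step-size $\alpha>0$, inner-loop length $q\ge1$ and minibatch size $B$. Start from $x_i^{0,1}=x_0\in\mathbb R^p$, $y_i^{0,1}=0$, $v_i^{-1,1}=0$ at every node $i=1,\dots,n$. For $s=1,2,\dots$ and $t=0,1,\dots,q$ set $$v_i^{0,s}=\nabla f_i(x_i^{0,s}),\qquad v_i^{t,s}=\tfrac1B\sum_{l=1}^B\big(\nabla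 f_{i,\tau_{i,l}^{t,s}}(x_i^{t,s})-\nabla f_{i,\tau_{i,l}^{t,s}}(x_i^{t-1,s})\big)+v_i^{t-1,s}\quad(t\ge1),$$ $$y_i^{t+1,s}=\sum_{r} w_{ir}y_r^{t,s}+v_i^{t,s}-v_i^{t-1,s},\qquad x_i^{t+1,s}=\sum_{r} w_{ir}x_r^{t,s}-\alpha y_i^{t+1,s},$$ and then $x_i^{0,s+1}=x_i^{q+1,s}$, $y_i^{0,s+1}=y_i^{q+1,s}$, $v_i^{-1,s+1}=v_i^{q,s}$. The indices $\tau_{i,l}^{t,s}$ ($1\le t\le q$, $s\ge1$, $1\le i\le n$, $1\le l\le B$) are independent and uniform on $\{1,\dots,m\}$. Each outer iteration $s$ evaluates $n(m+2qB)$ component gradients over all nodes and uses $q+1$ rounds of communication (one for each $t$). With $\bar x^{t,s}:=\frac1n\sum_i x_i^{t,s}$, the algorithm *finds an $\epsilon$-accurate stationary point in $S\ge1$ outer iterations* if $$\frac1{S(q+1)}\sum_{s=1}^S\sum_{t=0}^q\frac1n\sum_{i=1}^n\mathbb E\big[\|\nabla F(x_i^{t,s})\|^2+L^2\|x_i^{t,s}-\bar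 x^{t,s}\|^2\big]\le\epsilon^2 .$$ Put $$\Delta:=L\,(F(x_0)-F^*)+\tfrac1n\sum_{i=1}^n\|\nabla f_i(x_0)\|^2,\qquad M:=\frac1L\min\Big\{(1-\lambda)^2,\ \frac{n^{1/2}B}{m^{1/2}},\ \frac{n^{1/3}B^{2/3}(1-\lambda)}{m^{1/3}}\Big\},$$ $$\mathcal H_B:=\max\Big\{\frac{nB}{(1-\lambda)^2},\ N^{1/2},\ \frac{m^{1/3}n^{2/3}B^{1/3}}{1-\lambda}\Big\}\frac{\Delta}{\epsilon^2},\qquad \mathcal K_B:=\max\Big\{\frac1{(1-\lambda)^2},\ \frac{m^{1/2}}{n^{1/2}B},\ \frac{m^{1/3}}{n^{1/3}B^{2/3}(1-\lambda)}\Big\}\frac{\Delta}{\epsilon^2}.$$ **Theorem.** For all constants $0<c_1\le c_2$ there is a constant $b>0$, depending only on $c_1,c_2$, such that for every $a\in(0,b]$ there is a constant $C>0$, depending only on $c_1,c_2,a$, with the following property. In every setting as above, if $$c_1\frac mB\le q\le c_2\frac mB,\qquad aM\le\alpha\le bM,$$ then for every $\epsilon>0$ there is $S\ge1$ such that GT-SARAH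 finds an $\epsilon$-accurate stationary point in $S$ outer iterations, and these use at most $C\max\{N,\mathcal H_B\}$ component gradient computations across all nodes and at most $C\max\{m/B,\mathcal K_B\}$ rounds of communication. In particular, whenever $\epsilon$ is small enough that $N\le\mathcal H_B$ (equivalently $m/B\le\mathcal K_B$), at most $C\,\mathcal H_B$ component gradient computations and at most $C\,\mathcal K_B$ rounds of communication are used. -/

import Mathlib

open MeasureTheory ProbabilityTheory

noncomputable section

namespace GTSarah

/-- The decision space `ℝ^p` with its Euclidean norm. -/
abbrev Vec (p : ℕ) := EuclideanSpace ℝ (Fin p)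

/-- The local cost `f_i = (1/m) ∑_j f_{i,j}` of node `i`. -/
def localCost {n m p : ℕ} (f : Fin n → Fin m → Vec p → ℝ) (i : Fin n) (x : Vec p) : ℝ :=
  (1 / (m : ℝ)) * ∑ j, f i j x

/-- The global cost `F = (1/n) ∑_i f_i`. -/
def globalCost {n m p : ℕ} (f : Fin n → Fin m → Vec p → ℝ) (x : Vec p) : ℝ :=
  (1 / (n : ℝ)) * ∑ i, localCost f i x

/-- Differentiable component costs, local mean-squared smoothness with constant `L > 0`, and a
global cost that is bounded below. -/
structure SmoothCosts {n m p : ℕ} (f : Fin n → Fin m → Vec p → ℝ) (L : ℝ) : Prop where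
  L_pos : 0 < L
  differentiable : ∀ i j, Differentiable ℝ (f i j)
  mean_square_smooth : ∀ (i : Fin n) (x y : Vec p),
    (1 / (m : ℝ)) * ∑ j, ‖gradient (f i j) x - gradient (f i j) y‖ ^ 2 ≤ L ^ 2 * ‖x - y‖ ^ 2
  bddBelow : BddBelow (Set.range (globalCost f))

/-- The weight matrix of the network: nonnegative, with positive diagonal, primitive and doubly
stochastic. (The network itself is the directed graph of the nonzero weights.) -/
structure NetworkWeights {n : ℕ} (W : Matrix (Fin n) (Fin n) ℝ) : Prop where
  diag_pos : ∀ i, 0 < W i i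
  primitive : W.IsPrimitive
  doublyStochastic : W ∈ doublyStochastic ℝ (Fin n)

/-- `λ = ‖W - (1/n) 1 1ᵀ‖`, in the spectral norm. -/
def netLambda {n : ℕ} (W : Matrix (Fin n) (Fin n) ℝ) : ℝ :=
  ‖Matrix.toEuclideanCLM (n := Fin n) (𝕜 := ℝ) (W - Matrix.of fun _ _ => 1 / (n : ℝ))‖

/-- The sampled indices `τ_{i,l}^{t,s}`, `1 ≤ t ≤ q`, `i` a node, `1 ≤ l ≤ B`, are independent and
each is uniform on the `m` local indices. The outer index `s` counts from `0` here, so that `τ s`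
belongs to the outer iteration number `s + 1`. The values `τ s t` with `t = 0` or `t > q` are never
used by the first `q + 1` steps of an outer iteration, and nothing is asked of them. -/
structure UniformSampling {Ω : Type*} [MeasurableSpace Ω] (P : Measure Ω) {n m B : ℕ} (q : ℕ)
    (τ : ℕ → ℕ → Fin n → Fin B → Ω → Fin m) : Prop where
  measurable : ∀ (s t : ℕ) (i : Fin n) (l : Fin B), 1 ≤ t → t ≤ q → Measurable (τ s t i l)
  uniform : ∀ (s t : ℕ) (i : Fin n) (l : Fin B), 1 ≤ t → t ≤ q →
    ∀ j : Fin m, P {ω | τ s t i l ω = j} = (m : ENNReal)⁻¹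
  indep : iIndepFun
    (fun k : ℕ × Fin q × Fin n × Fin B => τ k.1 ((k.2.1 : ℕ) + 1) k.2.2.1 k.2.2.2) P

/-- What the nodes hold on entering step `t` of outer iteration `s`: `x = x^{t,s}`,
`xPrev = x^{t-1,s}`, `y = y^{t,s}` and `v = v^{t-1,s}`. -/
structure State (n p : ℕ) where
  x : Fin n → Vec p
  xPrev : Fin n → Vec p
  y : Fin n → Vec p
  v : Fin n → Vec p

/-- One round of communication: every node forms the weighted sum of its neighbors' vectors. -/
def mix {n p : ℕ} (W : Matrix (Fin n) (Fin n) ℝ) (z : Fin n → Vec p) (i : Fin n) : Vec p :=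
  ∑ r, W i r • z r

/-- The estimator `v_i^{t,s}`: the local batch gradient at `t = 0`, the recursive minibatch
estimator at `t ≥ 1`. -/
def estimator {n m p B : ℕ} (f : Fin n → Fin m → Vec p → ℝ) (t : ℕ)
    (τ : Fin n → Fin B → Fin m) (z : State n p) (i : Fin n) : Vec p :=
  if t = 0 then (1 / (m : ℝ)) • ∑ j, gradient (f i j) (z.x i)
  else (1 / (B : ℝ)) • ∑ l, (gradient (f i (τ i l)) (z.x i) - gradient (f i (τ i l)) (z.xPrev i))
    + z.v i

/-- Step `t` of an outer iteration, for all nodes: the gradient estimator, then the tracking update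
`y^{t+1} = W y^t + v^t - v^{t-1}`, then the state update `x^{t+1} = W x^t - α y^{t+1}`. -/
def step {n m p B : ℕ} (f : Fin n → Fin m → Vec p → ℝ) (W : Matrix (Fin n) (Fin n) ℝ) (α : ℝ)
    (t : ℕ) (τ : Fin n → Fin B → Fin m) (z : State n p) : State n p :=
  let v' : Fin n → Vec p := estimator f t τ z
  let y' : Fin n → Vec p := fun i => mix W z.y i + v' i - z.v i
  { x := fun i => mix W z.x i - α • y' i
    xPrev := z.x
    y := y'
    v := v' }

/-- The state on entering step `t` of an outer iteration that starts from the state `z`. -/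
def innerState {n m p B : ℕ} (f : Fin n → Fin m → Vec p → ℝ) (W : Matrix (Fin n) (Fin n) ℝ)
    (α : ℝ) (τ : ℕ → Fin n → Fin B → Fin m) (z : State n p) : ℕ → State n p
  | 0 => z
  | t + 1 => step f W α t (τ t) (innerState f W α τ z t)

/-- The state on entering outer iteration number `s + 1`. All nodes start from the point `x₀`, with
zero tracker and zero estimator; an outer iteration consists of the steps `t = 0, …, q`. -/
def outerState {n m p B : ℕ} (f : Fin n → Fin m → Vec p → ℝ) (W : Matrix (Fin n) (Fin n) ℝ)
    (α : ℝ) (q : ℕ) (x₀ : Vec p) (τ : ℕ → ℕ → Fin n → Fin B → Fin m) : ℕ → State n p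
  | 0 => { x := fun _ => x₀, xPrev := fun _ => x₀, y := fun _ => 0, v := fun _ => 0 }
  | s + 1 => innerState f W α (τ s) (outerState f W α q x₀ τ s) (q + 1)

/-- The iterate of node `i` at step `t` of outer iteration number `s + 1`. -/
def iterate {n m p B : ℕ} (f : Fin n → Fin m → Vec p → ℝ) (W : Matrix (Fin n) (Fin n) ℝ)
    (α : ℝ) (q : ℕ) (x₀ : Vec p) (τ : ℕ → ℕ → Fin n → Fin B → Fin m) (s t : ℕ) (i : Fin n) :
    Vec p :=
  (innerState f W α (τ s) (outerState f W α q x₀ τ s) t).x i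

/-- The average of the vectors held by the nodes. -/
def nodeMean {n p : ℕ} (x : Fin n → Vec p) : Vec p := (1 / (n : ℝ)) • ∑ i, x i

/-- Squared stationarity gap plus `L²` times the squared consensus error of node `i`, when the nodes
hold the vectors `x`. -/
def gap {n m p : ℕ} (f : Fin n → Fin m → Vec p → ℝ) (L : ℝ) (x : Fin n → Vec p) (i : Fin n) : ℝ :=
  ‖gradient (globalCost f) (x i)‖ ^ 2 + L ^ 2 * ‖x i - nodeMean x‖ ^ 2

/-- The algorithm finds an `ε`-accurate stationary point in `S ≥ 1` outer iterations: the mean of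
the expected gaps, over all nodes, steps and outer iterations, is at most `ε²`. The expectations
are required to exist. -/
def FindsStationary {Ω : Type*} [MeasurableSpace Ω] (P : Measure Ω) {n m p B : ℕ}
    (f : Fin n → Fin m → Vec p → ℝ) (W : Matrix (Fin n) (Fin n) ℝ) (L α : ℝ) (q : ℕ)
    (x₀ : Vec p) (τ : ℕ → ℕ → Fin n → Fin B → Ω → Fin m) (S : ℕ) (ε : ℝ) : Prop :=
  let X : ℕ → ℕ → Ω → Fin n → Vec p :=
    fun s t ω => iterate f W α q x₀ (fun s t i l => τ s t i l ω) s t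
  1 ≤ S ∧
  (∀ s t i, s < S → t ≤ q → Integrable (fun ω => gap f L (X s t ω) i) P) ∧
  (1 / ((S : ℝ) * ((q : ℝ) + 1))) *
    ∑ s ∈ Finset.range S, ∑ t ∈ Finset.range (q + 1),
      (1 / (n : ℝ)) * ∑ i, ∫ ω, gap f L (X s t ω) i ∂P ≤ ε ^ 2

/-- Component gradients evaluated at step `t` of an outer iteration, over all nodes: `m` per node
at `t = 0`, two minibatches of size `B` per node at `t ≥ 1`. -/
def stepGradients (n m B t : ℕ) : ℕ := if t = 0 then n * m else n * (2 * B)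

/-- Component gradients evaluated in the first `S` outer iterations, over all nodes. -/
def totalGradients (n m B q S : ℕ) : ℕ :=
  ∑ _s ∈ Finset.range S, ∑ t ∈ Finset.range (q + 1), stepGradients n m B t

/-- Communication rounds in the first `S` outer iterations. Every step, including the step `t = 0`,
uses one round, in which each node receives its neighbors' `x` and `y`. -/
def totalRounds (q S : ℕ) : ℕ :=
  ∑ _s ∈ Finset.range S, ∑ _t ∈ Finset.range (q + 1), 1

/-- `Δ = L (F(x₀) - F^*) + (1/n) ∑_i ‖∇f_i(x₀)‖²`, where `F^* = inf F`. -/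
def initialGap {n m p : ℕ} (f : Fin n → Fin m → Vec p → ℝ) (L : ℝ) (x₀ : Vec p) : ℝ :=
  L * (globalCost f x₀ - ⨅ x, globalCost f x)
    + (1 / (n : ℝ)) * ∑ i, ‖gradient (localCost f i) x₀‖ ^ 2

/-- `min {(1-λ)², n^{1/2} B / m^{1/2}, n^{1/3} B^{2/3} (1-λ) / m^{1/3}} / L`. -/
def stepScale (n m B : ℕ) (lam L : ℝ) : ℝ :=
  min ((1 - lam) ^ 2)
    (min ((n : ℝ) ^ (1 / 2 : ℝ) * B / (m : ℝ) ^ (1 / 2 : ℝ))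
      ((n : ℝ) ^ (1 / 3 : ℝ) * (B : ℝ) ^ (2 / 3 : ℝ) * (1 - lam) / (m : ℝ) ^ (1 / 3 : ℝ))) / L

/-- `max {nB / (1-λ)², N^{1/2}, m^{1/3} n^{2/3} B^{1/3} / (1-λ)} Δ / ε²`, where `N = nm`. -/
def gradientRate (n m B : ℕ) (lam Δ ε : ℝ) : ℝ :=
  max ((n : ℝ) * B / (1 - lam) ^ 2)
    (max (((n : ℝ) * m) ^ (1 / 2 : ℝ))
      ((m : ℝ) ^ (1 / 3 : ℝ) * (n : ℝ) ^ (2 / 3 : ℝ) * (B : ℝ) ^ (1 / 3 : ℝ) / (1 - lam)))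
    * (Δ / ε ^ 2)

/-- `max {1 / (1-λ)², m^{1/2} / (n^{1/2} B), m^{1/3} / (n^{1/3} B^{2/3} (1-λ))} Δ / ε²`. -/
def roundRate (n m B : ℕ) (lam Δ ε : ℝ) : ℝ :=
  max (1 / (1 - lam) ^ 2)
    (max ((m : ℝ) ^ (1 / 2 : ℝ) / ((n : ℝ) ^ (1 / 2 : ℝ) * B))
      ((m : ℝ) ^ (1 / 3 : ℝ) / ((n : ℝ) ^ (1 / 3 : ℝ) * (B : ℝ) ^ (2 / 3 : ℝ) * (1 - lam))))
    * (Δ / ε ^ 2)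

end GTSarah

end

/-! Mixing preserves node means, so the tracker mean equals the estimator mean and the mean iterate
performs `x̄ ↦ x̄ - α v̄`. The descent lemma charges each such step with the error of the mean
estimator and with the consensus error, and leaves a negative multiple of `‖v̄‖²` to pay for both
(`globalCost_nodeMean_succ_le`).

The estimator error vanishes at the start of every outer iteration and then grows by centered
increments, orthogonal across nodes and minibatch samples, with variance bounded by the displacement
of the iterates. Orthogonality gains a factor `1/(nB)`, and each displacement is counted at most `q`
times. The summed error is therefore at most `ρ = q/(nB)` times the summed scaled displacement
(`expect_norm_sum_estimatorError_sq_le`, `sum_le_of_reset`). The consensus error comes from two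
`λ`-contractions in cascade: estimator changes drive the tracker, and the tracker drives the
iterates. Each costs a factor of order `(1-λ)⁻²` after summation. The displacement is in turn
bounded by the consensus error and `α²‖v̄‖²`.

With `u = αL`, this loop closes if `u`, `ρu²` and `ρu³` are small multiples of `(1-λ)²`, `1` and
`(1-λ)³`. As `q` is at most of order `m/B`, `ρ` is at most of order `m/(nB²)`, and the three terms
of the step-size bound ensure these conditions. Then the expected gaps sum to at most `5Δ/(αL)` over
any number of steps (`resolve_coupled_bounds`, `sum_expect_gap_le`). About `5Δ/(αLε²)` steps,
rounded up to whole outer iterations, suffice, at an amortized cost of order `nB` gradients per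
round.

A finite run uses finitely many indices, jointly uniform on a finite set. Expectations are thus
finite averages `𝔼`, and conditioning becomes averaging over a single coordinate. -/

open MeasureTheory ProbabilityTheory

noncomputable section

namespace GTSarah

/-! ### Doubly stochastic mixing: the spectral gap and contraction of disagreement. -/

section Network

variable {n p : ℕ} {W : Matrix (Fin n) (Fin n) ℝ}

/-- The spread of a doubly stochastic average: the loss of square norm under averaging. -/
lemma sum_weighted_sq_sub_average {M : Matrix (Fin n) (Fin n) ℝ}
    (hM : M ∈ doublyStochastic ℝ (Fin n)) (z : Fin n → ℝ) :
    ∑ i, ∑ r, M i r * (z r - ∑ k, M i k * z k) ^ 2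
      = ∑ r, z r ^ 2 - ∑ i, (∑ k, M i k * z k) ^ 2 := by
  have h1 : ∀ i, ∑ r, M i r * (z r - ∑ k, M i k * z k) ^ 2
      = ∑ r, M i r * z r ^ 2 - (∑ k, M i k * z k) ^ 2 := by
    intro i
    set a := ∑ k, M i k * z k with ha
    have : ∀ r, M i r * (z r - a) ^ 2 = M i r * z r ^ 2 - 2 * a * (M i r * z r) + a ^ 2 * M i r := by
      intro r; ring
    simp only [this, Finset.sum_add_distrib, Finset.sum_sub_distrib, ← Finset.mul_sum, ← ha,
      sum_row_of_mem_doublyStochastic hM i]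
    ring
  simp only [h1, Finset.sum_sub_distrib]
  congr 1
  rw [Finset.sum_comm]
  simp only [← Finset.sum_mul, sum_col_of_mem_doublyStochastic hM, one_mul]

lemma sum_weighted_sq_sub {M : Matrix (Fin n) (Fin n) ℝ}
    (hM : M ∈ doublyStochastic ℝ (Fin n)) {z : Fin n → ℝ} (hz : ∀ i, ∑ k, M i k * z k = z i) :
    ∑ i, ∑ r, M i r * (z r - z i) ^ 2 = 0 := by
  have := sum_weighted_sq_sub_average hM z
  simpa only [hz, sub_self] using this

lemma sum_sq_average_le (hW : W ∈ doublyStochastic ℝ (Fin n)) (z : Fin n → ℝ) :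
    ∑ i, (∑ k, W i k * z k) ^ 2 ≤ ∑ r, z r ^ 2 := by
  have h := sum_weighted_sq_sub_average hW z
  have : 0 ≤ ∑ i, ∑ r, W i r * (z r - ∑ k, W i k * z k) ^ 2 :=
    Finset.sum_nonneg fun i _ => Finset.sum_nonneg fun r _ =>
      mul_nonneg (nonneg_of_mem_doublyStochastic hW) (sq_nonneg _)
  linarith

/-- If averaging loses no square norm, every weighted deviation vanishes. The positive diagonal
turns this into `W z = z`, hence `W ^ k z = z`, and the same identity for an entrywise positive
power makes all entries equal. -/
lemma eq_const_of_sum_sq_average_eq (hW : NetworkWeights W) {z : Fin n → ℝ}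
    (h : ∑ i, (∑ k, W i k * z k) ^ 2 = ∑ r, z r ^ 2) (i j : Fin n) : z i = z j := by
  have hds := hW.doublyStochastic
  have h0 := sum_weighted_sq_sub_average hds z
  rw [h, sub_self] at h0
  have hnn : ∀ i r, 0 ≤ W i r * (z r - ∑ k, W i k * z k) ^ 2 := fun i r =>
    mul_nonneg (nonneg_of_mem_doublyStochastic hds) (sq_nonneg _)
  have hfix : W.mulVec z = z := by
    funext i
    have h1 := (Finset.sum_eq_zero_iff_of_nonneg
      (fun i _ => Finset.sum_nonneg fun r _ => hnn i r)).1 h0 i (Finset.mem_univ i)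
    have h2 := (Finset.sum_eq_zero_iff_of_nonneg (fun r _ => hnn i r)).1 h1 i (Finset.mem_univ i)
    have h3 := (mul_eq_zero.1 h2).resolve_left (hW.diag_pos i).ne'
    have h4 := pow_eq_zero_iff (two_ne_zero) |>.1 h3
    simp only [Matrix.mulVec, dotProduct]
    linarith
  have hpow : ∀ k : ℕ, (W ^ k).mulVec z = z := by
    intro k
    induction k with
    | zero => simp
    | succ k ih => rw [pow_succ, ← Matrix.mulVec_mulVec, hfix, ih]
  obtain ⟨k, -, hk⟩ := hW.primitive.exists_pos_pow
  have hkds : W ^ k ∈ doublyStochastic ℝ (Fin n) := pow_mem hds k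
  have h5 := sum_weighted_sq_sub hkds (z := z) (fun i => congrFun (hpow k) i)
  have hnn' : ∀ i r, 0 ≤ (W ^ k) i r * (z r - z i) ^ 2 := fun i r =>
    mul_nonneg (hk i r).le (sq_nonneg _)
  have h1 := (Finset.sum_eq_zero_iff_of_nonneg
    (fun i _ => Finset.sum_nonneg fun r _ => hnn' i r)).1 h5 j (Finset.mem_univ j)
  have h2 := (Finset.sum_eq_zero_iff_of_nonneg (fun r _ => hnn' j r)).1 h1 i (Finset.mem_univ i)
  have h3 := (mul_eq_zero.1 h2).resolve_left (hk j i).ne'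
  have h4 := pow_eq_zero_iff (two_ne_zero) |>.1 h3
  linarith

lemma sub_mean_mulVec_apply (W : Matrix (Fin n) (Fin n) ℝ) (z : Fin n → ℝ) (i : Fin n) :
    ((W - Matrix.of fun _ _ => 1 / (n : ℝ)).mulVec z) i
      = ∑ k, W i k * z k - (1 / (n : ℝ)) * ∑ k, z k := by
  simp [Matrix.mulVec, dotProduct, sub_mul, Finset.sum_sub_distrib, Finset.mul_sum]

lemma sub_mean_mulVec_eq (hW : W ∈ doublyStochastic ℝ (Fin n)) (z : Fin n → ℝ)
    (i : Fin n) :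
    ((W - Matrix.of fun _ _ => 1 / (n : ℝ)).mulVec z) i
      = ∑ k, W i k * (z k - (1 / (n : ℝ)) * ∑ r, z r) := by
  rw [sub_mean_mulVec_apply]
  simp only [mul_sub, Finset.sum_sub_distrib, ← Finset.sum_mul,
    sum_row_of_mem_doublyStochastic hW i, one_mul]

lemma sum_sq_sub_mean (hn : 1 ≤ n) (z : Fin n → ℝ) :
    ∑ i, (z i - (1 / (n : ℝ)) * ∑ r, z r) ^ 2
      = ∑ i, z i ^ 2 - n * ((1 / (n : ℝ)) * ∑ r, z r) ^ 2 := by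
  have hn' : (n : ℝ) ≠ 0 := by positivity
  set a := (1 / (n : ℝ)) * ∑ r, z r with ha
  have hs : ∑ r, z r = n * a := by rw [ha]; field_simp
  have : ∀ i, (z i - a) ^ 2 = z i ^ 2 - 2 * a * z i + a ^ 2 := fun i => by ring
  simp only [this, Finset.sum_add_distrib, Finset.sum_sub_distrib, ← Finset.mul_sum, hs,
    Finset.sum_const, Finset.card_univ, Fintype.card_fin, nsmul_eq_mul]
  ring

lemma sum_sq_sub_mean_mulVec_lt (hn : 1 ≤ n) (hW : NetworkWeights W) {z : Fin n → ℝ}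
    (hz : z ≠ 0) :
    ∑ i, ((W - Matrix.of fun _ _ => 1 / (n : ℝ)).mulVec z) i ^ 2 < ∑ i, z i ^ 2 := by
  have hn' : (n : ℝ) ≠ 0 := by positivity
  set a := (1 / (n : ℝ)) * ∑ r, z r with ha
  have hds := hW.doublyStochastic
  simp only [sub_mean_mulVec_eq hds]
  have h1 := sum_sq_average_le hds (fun k => z k - a)
  have h2 := sum_sq_sub_mean hn z
  rw [← ha] at h2
  have h3 : 0 ≤ (n : ℝ) * a ^ 2 := by positivity
  -- Equality forces the mean to be zero and the entries to be constant, hence `z = 0`.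
  refine lt_of_le_of_ne (by linarith) fun heq => hz ?_
  have h4 : (n : ℝ) * a ^ 2 = 0 := by linarith
  have ha0 : a = 0 := by simpa [hn'] using h4
  have h5 := eq_const_of_sum_sq_average_eq hW (z := fun k => z k - a) (by linarith)
  funext i
  have h6 : ∀ k, z k = z i := fun k => by have := h5 k i; linarith
  have h7 : a = z i := by
    rw [ha]
    simp only [h6, Finset.sum_const, Finset.card_univ, Fintype.card_fin, nsmul_eq_mul]
    field_simp
  rw [Pi.zero_apply, ← h7, ha0]

lemma netLambda_nonneg (W : Matrix (Fin n) (Fin n) ℝ) : 0 ≤ netLambda W := norm_nonneg _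

/-- Strict contraction of each nonzero vector yields a norm below one because, in finite dimension,
the supremum over the unit ball is attained. -/
lemma netLambda_lt_one (hn : 1 ≤ n) (hW : NetworkWeights W) : netLambda W < 1 := by
  unfold netLambda
  set A := W - Matrix.of fun _ _ => 1 / (n : ℝ) with hA
  set T := Matrix.toEuclideanCLM (n := Fin n) (𝕜 := ℝ) A with hT
  have hlt : ∀ x : EuclideanSpace ℝ (Fin n), x ≠ 0 → ‖T x‖ < ‖x‖ := by
    intro x hx
    have hz : (x.ofLp : Fin n → ℝ) ≠ 0 := by simpa using hx
    have := sum_sq_sub_mean_mulVec_lt hn hW hz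
    refine lt_of_pow_lt_pow_left₀ 2 (norm_nonneg _) ?_
    rw [EuclideanSpace.real_norm_sq_eq, EuclideanSpace.real_norm_sq_eq]
    exact this
  obtain ⟨x₀, hx₀, hmax⟩ := (isCompact_closedBall (0 : EuclideanSpace ℝ (Fin n)) 1).exists_isMaxOn
    ⟨0, by simp⟩ (f := fun x => ‖T x‖) (by fun_prop)
  have hc : ‖T x₀‖ < 1 := by
    by_cases h : x₀ = 0
    · simp [h]
    · exact (hlt x₀ h).trans_le (by simpa using hx₀)
  refine lt_of_le_of_lt (T.opNorm_le_bound (norm_nonneg (T x₀)) fun x => ?_) hc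
  by_cases h : x = 0
  · simp [h]
  have hxn : 0 < ‖x‖ := norm_pos_iff.2 h
  have h1 : ‖T (‖x‖⁻¹ • x)‖ ≤ ‖T x₀‖ := hmax (by simp [norm_smul, hxn.ne'])
  rw [map_smul, norm_smul, norm_inv, norm_norm, inv_mul_le_iff₀ hxn] at h1
  linarith

lemma sum_sq_sub_mean_mulVec_le (W : Matrix (Fin n) (Fin n) ℝ) (z : Fin n → ℝ) :
    ∑ i, ((W - Matrix.of fun _ _ => 1 / (n : ℝ)).mulVec z) i ^ 2
      ≤ netLambda W ^ 2 * ∑ i, z i ^ 2 := by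
  have h := (Matrix.toEuclideanCLM (n := Fin n) (𝕜 := ℝ)
    (W - Matrix.of fun _ _ => 1 / (n : ℝ))).le_opNorm (WithLp.toLp 2 z)
  have h2 := pow_le_pow_left₀ (norm_nonneg _) h 2
  rw [mul_pow, EuclideanSpace.real_norm_sq_eq, EuclideanSpace.real_norm_sq_eq] at h2
  exact h2

lemma nodeMean_apply (z : Fin n → Vec p) (c : Fin p) :
    nodeMean z c = (1 / (n : ℝ)) * ∑ i, z i c := by
  simp [nodeMean]

lemma mix_apply (W : Matrix (Fin n) (Fin n) ℝ) (z : Fin n → Vec p) (i : Fin n) (c : Fin p) :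
    mix W z i c = ∑ r, W i r * z r c := by
  simp [mix]

lemma nodeMean_mix (hW : W ∈ doublyStochastic ℝ (Fin n)) (z : Fin n → Vec p) :
    nodeMean (mix W z) = nodeMean z := by
  ext c
  simp only [nodeMean_apply, mix_apply]
  rw [Finset.sum_comm]
  simp only [← Finset.sum_mul, sum_col_of_mem_doublyStochastic hW, one_mul]

lemma nodeMean_add (z w : Fin n → Vec p) :
    nodeMean (fun i => z i + w i) = nodeMean z + nodeMean w := by
  simp [nodeMean, Finset.sum_add_distrib]

lemma nodeMean_sub (z w : Fin n → Vec p) :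
    nodeMean (fun i => z i - w i) = nodeMean z - nodeMean w := by
  simp [nodeMean, Finset.sum_sub_distrib, smul_sub]

lemma nodeMean_smul (a : ℝ) (z : Fin n → Vec p) :
    nodeMean (fun i => a • z i) = a • nodeMean z := by
  simp [nodeMean, ← Finset.smul_sum, smul_comm a]

lemma nodeMean_const (hn : 1 ≤ n) (x : Vec p) : nodeMean (fun _ : Fin n => x) = x := by
  have hn' : (n : ℝ) ≠ 0 := by positivity
  simp [nodeMean, ← Nat.cast_smul_eq_nsmul ℝ, smul_smul, hn']

/-- The squared distance of the node vectors to their mean. -/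
def disagreement (z : Fin n → Vec p) : ℝ := ∑ i, ‖z i - nodeMean z‖ ^ 2

lemma disagreement_nonneg (z : Fin n → Vec p) : 0 ≤ disagreement z :=
  Finset.sum_nonneg fun _ _ => sq_nonneg _

lemma disagreement_const (hn : 1 ≤ n) (x : Vec p) : disagreement (fun _ : Fin n => x) = 0 := by
  simp [disagreement, nodeMean_const hn]

lemma disagreement_eq (z : Fin n → Vec p) :
    disagreement z = ∑ c, ∑ i, (z i c - (1 / (n : ℝ)) * ∑ r, z r c) ^ 2 := by
  rw [Finset.sum_comm]
  simp [disagreement, EuclideanSpace.real_norm_sq_eq, nodeMean_apply]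

lemma disagreement_le (hn : 1 ≤ n) (z : Fin n → Vec p) : disagreement z ≤ ∑ i, ‖z i‖ ^ 2 := by
  simp only [EuclideanSpace.real_norm_sq_eq]
  rw [disagreement_eq, Finset.sum_comm (s := Finset.univ (α := Fin n))]
  refine Finset.sum_le_sum fun c _ => ?_
  rw [sum_sq_sub_mean hn]
  have : 0 ≤ (n : ℝ) * ((1 / (n : ℝ)) * ∑ r, z r c) ^ 2 := by positivity
  linarith

/-- Deviations from the mean sum to zero, so on them `W` acts as `W - (1/n) 1 1ᵀ`; the spectral norm
is applied coordinate by coordinate. -/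
lemma disagreement_mix_le (hn : 1 ≤ n) (hW : W ∈ doublyStochastic ℝ (Fin n)) (z : Fin n → Vec p) :
    disagreement (mix W z) ≤ netLambda W ^ 2 * disagreement z := by
  rw [disagreement, nodeMean_mix hW]
  simp only [EuclideanSpace.real_norm_sq_eq]
  rw [disagreement_eq, Finset.sum_comm, Finset.mul_sum]
  refine Finset.sum_le_sum fun c _ => ?_
  have hn' : (n : ℝ) ≠ 0 := by positivity
  have h := sum_sq_sub_mean_mulVec_le W (fun i => z i c - (1 / (n : ℝ)) * ∑ r, z r c)
  have h0 : ∑ i, (z i c - (1 / (n : ℝ)) * ∑ r, z r c) = 0 := by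
    simp only [Finset.sum_sub_distrib, Finset.sum_const, Finset.card_univ, Fintype.card_fin,
      nsmul_eq_mul]
    field_simp
    ring
  refine le_trans (le_of_eq (Finset.sum_congr rfl fun i _ => ?_)) h
  rw [sub_mean_mulVec_apply, h0]
  simp only [PiLp.sub_apply, mix_apply, nodeMean_apply, mul_sub, Finset.sum_sub_distrib,
    ← Finset.sum_mul, sum_row_of_mem_doublyStochastic hW i]
  ring

lemma norm_add_sq_le_of_pos {E : Type*} [NormedAddCommGroup E] {η : ℝ} (hη : 0 < η) (u w : E) :
    ‖u + w‖ ^ 2 ≤ (1 + η) * ‖u‖ ^ 2 + (1 + 1 / η) * ‖w‖ ^ 2 := by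
  have h1 : ‖u + w‖ ^ 2 ≤ (‖u‖ + ‖w‖) ^ 2 := pow_le_pow_left₀ (norm_nonneg _) (norm_add_le u w) 2
  have h2 : (1 + η) * ‖u‖ ^ 2 + (1 + 1 / η) * ‖w‖ ^ 2 - (‖u‖ + ‖w‖) ^ 2
      = (η * ‖u‖ - ‖w‖) ^ 2 / η := by field_simp; ring
  have h3 : 0 ≤ (η * ‖u‖ - ‖w‖) ^ 2 / η := by positivity
  linarith

/-- Young's inequality with parameter `1 - λ` gives up one power of `λ` to separate the
perturbation, whose cost is then only of order `1/(1-λ)`. -/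
lemma disagreement_mix_add_le (hn : 1 ≤ n) (hW : NetworkWeights W) (z w : Fin n → Vec p) :
    disagreement (fun i => mix W z i + w i)
      ≤ netLambda W * disagreement z + 2 / (1 - netLambda W) * disagreement w := by
  have hl1 := netLambda_lt_one hn hW
  have hl0 := netLambda_nonneg W
  set l := netLambda W
  have hη : 0 < 1 - l := by linarith
  have h1 : disagreement (fun i => mix W z i + w i)
      ≤ (1 + (1 - l)) * disagreement (mix W z) + (1 + 1 / (1 - l)) * disagreement w := by
    simp only [disagreement, Finset.mul_sum, ← Finset.sum_add_distrib, nodeMean_add]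
    refine Finset.sum_le_sum fun i _ => ?_
    rw [add_sub_add_comm]
    exact norm_add_sq_le_of_pos hη _ _
  have h2 := disagreement_mix_le hn hW.doublyStochastic z
  -- The difference of the two sides is `l * (1 - l) ^ 2`.
  have h3 : (1 + (1 - l)) * l ^ 2 ≤ l := by nlinarith [mul_nonneg hl0 (sq_nonneg (1 - l))]
  have h4 : 1 + 1 / (1 - l) ≤ 2 / (1 - l) := by
    have : 1 ≤ 1 / (1 - l) := by rw [le_div_iff₀ hη]; linarith
    have e : 2 / (1 - l) = 1 / (1 - l) + 1 / (1 - l) := by ring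
    linarith
  calc _ ≤ _ := h1
    _ ≤ (1 + (1 - l)) * (l ^ 2 * disagreement z) + (2 / (1 - l)) * disagreement w :=
        add_le_add (mul_le_mul_of_nonneg_left h2 (by linarith))
          (mul_le_mul_of_nonneg_right h4 (disagreement_nonneg w))
    _ ≤ _ := by
        have := mul_le_mul_of_nonneg_right h3 (disagreement_nonneg z)
        linarith

lemma disagreement_smul (a : ℝ) (z : Fin n → Vec p) :
    disagreement (fun i => a • z i) = a ^ 2 * disagreement z := by
  simp only [disagreement, nodeMean_smul, ← smul_sub, norm_smul, mul_pow, Finset.mul_sum,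
    Real.norm_eq_abs, sq_abs]

lemma norm_sum_sq_le {ι : Type*} (s : Finset ι) {E : Type*} [NormedAddCommGroup E]
    (g : ι → E) : ‖∑ i ∈ s, g i‖ ^ 2 ≤ s.card * ∑ i ∈ s, ‖g i‖ ^ 2 :=
  (pow_le_pow_left₀ (norm_nonneg _) (norm_sum_le s g) 2).trans sq_sum_le_card_mul_sum_sq

lemma norm_average_sq_le (z : Fin n → Vec p) :
    ‖(1 / (n : ℝ)) • ∑ i, z i‖ ^ 2 ≤ (1 / (n : ℝ)) * ∑ i, ‖z i‖ ^ 2 := by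
  rcases Nat.eq_zero_or_pos n with rfl | hn
  · simp
  have hn' : (0 : ℝ) < n := by exact_mod_cast hn
  have h := norm_sum_sq_le Finset.univ z
  rw [norm_smul, mul_pow, Real.norm_eq_abs, sq_abs]
  calc (1 / (n : ℝ)) ^ 2 * ‖∑ i, z i‖ ^ 2
      ≤ (1 / (n : ℝ)) ^ 2 * (n * ∑ i, ‖z i‖ ^ 2) := by
        refine mul_le_mul_of_nonneg_left ?_ (by positivity)
        simpa using h
    _ = _ := by field_simp

end Network

/-! ### Lipschitz gradients, the descent lemma and the stationarity gap. -/

section Smoothness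

variable {n m p : ℕ} {f : Fin n → Fin m → Vec p → ℝ} {L : ℝ}

lemma hasGradientAt_average {k : ℕ} {g : Fin k → Vec p → ℝ} {g' : Fin k → Vec p} {x : Vec p}
    (h : ∀ j, HasGradientAt (g j) (g' j) x) :
    HasGradientAt (fun y => (1 / (k : ℝ)) * ∑ j, g j y) ((1 / (k : ℝ)) • ∑ j, g' j) x := by
  rw [hasGradientAt_iff_hasFDerivAt]
  have h1 := (HasFDerivAt.fun_sum (u := Finset.univ)
    fun j _ => (h j).hasFDerivAt).const_mul (1 / (k : ℝ))
  simpa only [map_smul, map_sum] using h1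

lemma SmoothCosts.hasGradientAt_localCost (hf : SmoothCosts f L) (i : Fin n) (x : Vec p) :
    HasGradientAt (localCost f i) ((1 / (m : ℝ)) • ∑ j, gradient (f i j) x) x :=
  hasGradientAt_average fun j => (hf.differentiable i j x).hasGradientAt

lemma SmoothCosts.gradient_localCost (hf : SmoothCosts f L) (i : Fin n) (x : Vec p) :
    gradient (localCost f i) x = (1 / (m : ℝ)) • ∑ j, gradient (f i j) x :=
  (hf.hasGradientAt_localCost i x).gradient

lemma SmoothCosts.hasGradientAt_globalCost (hf : SmoothCosts f L) (x : Vec p) :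
    HasGradientAt (globalCost f) (gradient (globalCost f) x) x := by
  have h : HasGradientAt (globalCost f) (nodeMean fun i => gradient (localCost f i) x) x :=
    hasGradientAt_average fun i => by
      rw [hf.gradient_localCost]; exact hf.hasGradientAt_localCost i x
  rwa [h.gradient]

lemma SmoothCosts.gradient_globalCost (hf : SmoothCosts f L) (x : Vec p) :
    gradient (globalCost f) x = nodeMean fun i => gradient (localCost f i) x := by
  have h : HasGradientAt (globalCost f) (nodeMean fun i => gradient (localCost f i) x) x :=
    hasGradientAt_average fun i => by
      rw [hf.gradient_localCost]; exact hf.hasGradientAt_localCost i x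
  exact h.gradient

lemma SmoothCosts.norm_gradient_localCost_sub_sq_le (hf : SmoothCosts f L) (i : Fin n)
    (x y : Vec p) :
    ‖gradient (localCost f i) x - gradient (localCost f i) y‖ ^ 2 ≤ L ^ 2 * ‖x - y‖ ^ 2 := by
  rw [hf.gradient_localCost, hf.gradient_localCost, ← smul_sub, ← Finset.sum_sub_distrib]
  exact (norm_average_sq_le _).trans (hf.mean_square_smooth i x y)

lemma SmoothCosts.norm_nodeMean_gradient_sub_sq_le (hf : SmoothCosts f L) (x y : Fin n → Vec p) :
    ‖(nodeMean fun i => gradient (localCost f i) (x i))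
      - nodeMean fun i => gradient (localCost f i) (y i)‖ ^ 2
      ≤ L ^ 2 * ((1 / (n : ℝ)) * ∑ i, ‖x i - y i‖ ^ 2) := by
  rw [← nodeMean_sub]
  refine (norm_average_sq_le _).trans ?_
  rw [mul_left_comm, Finset.mul_sum _ _ (L ^ 2)]
  exact mul_le_mul_of_nonneg_left
    (Finset.sum_le_sum fun i _ => hf.norm_gradient_localCost_sub_sq_le i _ _) (by positivity)

lemma SmoothCosts.norm_gradient_globalCost_sub_le (hn : 1 ≤ n) (hf : SmoothCosts f L)
    (x y : Vec p) :
    ‖gradient (globalCost f) x - gradient (globalCost f) y‖ ≤ L * ‖x - y‖ := by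
  have hn' : (n : ℝ) ≠ 0 := by positivity
  have h := hf.norm_nodeMean_gradient_sub_sq_le (fun _ => x) (fun _ => y)
  rw [← hf.gradient_globalCost, ← hf.gradient_globalCost] at h
  simp only [Finset.sum_const, Finset.card_univ, Fintype.card_fin, nsmul_eq_mul] at h
  rw [← mul_assoc (1 / (n : ℝ)), one_div_mul_cancel hn', one_mul, ← mul_pow] at h
  exact (sq_le_sq₀ (norm_nonneg _) (mul_nonneg hf.L_pos.le (norm_nonneg _))).1 h

lemma SmoothCosts.globalCost_le (hn : 1 ≤ n) (hf : SmoothCosts f L) (x d : Vec p) :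
    globalCost f (x + d)
      ≤ globalCost f x + inner ℝ (gradient (globalCost f) x) d + L / 2 * ‖d‖ ^ 2 := by
  set F := globalCost f with hF
  have hline : ∀ t : ℝ, HasDerivAt (fun t : ℝ => F (x + t • d))
      (inner ℝ (gradient F (x + t • d)) d) t := by
    intro t
    have h1 : HasDerivAt (fun t : ℝ => x + t • d) d t := by
      simpa using ((hasDerivAt_id t).smul_const d).const_add x
    have h2 := (hf.hasGradientAt_globalCost (x + t • d)).hasFDerivAt.comp_hasDerivAt t h1
    rw [InnerProductSpace.toDual_apply_apply] at h2
    exact h2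
  have hder : ∀ t : ℝ, HasDerivAt
      (fun t : ℝ => F (x + t • d) - t * inner ℝ (gradient F x) d - L / 2 * ‖d‖ ^ 2 * t ^ 2)
      (inner ℝ (gradient F (x + t • d)) d - inner ℝ (gradient F x) d
        - L / 2 * ‖d‖ ^ 2 * (2 * t)) t := by
    intro t
    have h2 := ((hasDerivAt_id t).mul_const (inner ℝ (gradient F x) d))
    have h3 := ((hasDerivAt_pow 2 t).const_mul (L / 2 * ‖d‖ ^ 2))
    exact (((hline t).fun_sub h2).fun_sub h3).congr_deriv (by push_cast; ring)
  -- The Lipschitz gradient makes the cost along the segment, minus its quadratic upper model,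
  -- nonincreasing; comparing the endpoints gives the claim.
  have hanti : AntitoneOn
      (fun t : ℝ => F (x + t • d) - t * inner ℝ (gradient F x) d - L / 2 * ‖d‖ ^ 2 * t ^ 2)
      (Set.Icc 0 1) := by
    refine antitoneOn_of_deriv_nonpos (convex_Icc 0 1)
      (fun t _ => (hder t).continuousAt.continuousWithinAt)
      (fun t _ => (hder t).differentiableAt.differentiableWithinAt) fun t ht => ?_
    rw [interior_Icc] at ht
    rw [(hder t).deriv, ← inner_sub_left]
    have h1 := real_inner_le_norm (gradient F (x + t • d) - gradient F x) d
    have h2 := hf.norm_gradient_globalCost_sub_le hn (x + t • d) x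
    rw [add_sub_cancel_left, norm_smul, Real.norm_eq_abs, abs_of_pos ht.1] at h2
    nlinarith [mul_le_mul_of_nonneg_right h2 (norm_nonneg d)]
  have h := hanti (Set.left_mem_Icc.2 zero_le_one) (Set.right_mem_Icc.2 zero_le_one) zero_le_one
  simp only [one_smul, zero_smul, add_zero, one_mul, zero_mul, sub_zero, one_pow, mul_one] at h
  linarith

/-- One step along `-α v` decreases the cost up to the error of `v` as a gradient estimate. -/
lemma SmoothCosts.globalCost_sub_smul_le (hn : 1 ≤ n) (hf : SmoothCosts f L) {α : ℝ}
    (x v : Vec p) :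
    globalCost f (x - α • v) ≤ globalCost f x - α / 2 * ‖gradient (globalCost f) x‖ ^ 2
      - α / 2 * (1 - L * α) * ‖v‖ ^ 2 + α / 2 * ‖v - gradient (globalCost f) x‖ ^ 2 := by
  have h := hf.globalCost_le hn x (-(α • v))
  rw [← sub_eq_add_neg, inner_neg_right, inner_smul_right, norm_neg, norm_smul, mul_pow,
    Real.norm_eq_abs, sq_abs] at h
  have h2 := norm_sub_sq_real v (gradient (globalCost f) x)
  rw [real_inner_comm] at h2
  rw [h2]
  linarith

lemma SmoothCosts.iInf_le (hf : SmoothCosts f L) (x : Vec p) :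
    ⨅ y, globalCost f y ≤ globalCost f x := ciInf_le hf.bddBelow x

lemma SmoothCosts.gap_le (hn : 1 ≤ n) (hf : SmoothCosts f L) (x : Fin n → Vec p) :
    (1 / (n : ℝ)) * ∑ i, gap f L x i ≤ 2 * ‖gradient (globalCost f) (nodeMean x)‖ ^ 2
      + 3 * (L ^ 2 / n * disagreement x) := by
  have hn' : (n : ℝ) ≠ 0 := by positivity
  have h : ∀ i, gap f L x i ≤ 2 * ‖gradient (globalCost f) (nodeMean x)‖ ^ 2
      + 3 * L ^ 2 * ‖x i - nodeMean x‖ ^ 2 := by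
    intro i
    have h1 := norm_add_sq_le_of_pos one_pos (gradient (globalCost f) (nodeMean x))
      (gradient (globalCost f) (x i) - gradient (globalCost f) (nodeMean x))
    rw [add_sub_cancel] at h1
    have h2 := pow_le_pow_left₀ (norm_nonneg _)
      (hf.norm_gradient_globalCost_sub_le hn (x i) (nodeMean x)) 2
    rw [mul_pow] at h2
    unfold gap
    linarith
  calc _ ≤ (1 / (n : ℝ)) * ∑ i, (2 * ‖gradient (globalCost f) (nodeMean x)‖ ^ 2
      + 3 * L ^ 2 * ‖x i - nodeMean x‖ ^ 2) :=
        mul_le_mul_of_nonneg_left (Finset.sum_le_sum fun i _ => h i) (by positivity)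
    _ = _ := by
        simp only [Finset.sum_add_distrib, Finset.sum_const, Finset.card_univ, Fintype.card_fin,
          nsmul_eq_mul, ← Finset.mul_sum, disagreement]
        field_simp

end Smoothness

/-! ### Orthogonality under uniform averages over finitely many coordinates. -/

section UniformAverage

open scoped BigOperators

variable {ι : Type*} [DecidableEq ι] {m : ℕ}
variable {E : Type*} [NormedAddCommGroup E] [InnerProductSpace ℝ E]

/-- `g` does not depend on the coordinate `κ`. -/
def Ignores {β : Type*} (κ : ι) (g : (ι → Fin m) → β) : Prop :=
  ∀ σ j, g (Function.update σ κ j) = g σ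

/-- `ξ` has mean zero over the coordinate `κ`. -/
def Centered (κ : ι) (ξ : (ι → Fin m) → E) : Prop :=
  ∀ σ, ∑ j, ξ (Function.update σ κ j) = 0

/-- The deviation of the sampled value of `h` from its average over the coordinate `κ`. -/
def deviation (κ : ι) (h : (ι → Fin m) → Fin m → E) (σ : ι → Fin m) : E :=
  h σ (σ κ) - (1 / (m : ℝ)) • ∑ j, h σ j

lemma centered_deviation (hm : 1 ≤ m) {κ : ι} {h : (ι → Fin m) → Fin m → E} (hh : Ignores κ h) :
    Centered κ (deviation κ h) := by
  have hm' : (m : ℝ) ≠ 0 := by positivity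
  intro σ
  simp only [deviation, hh σ, Function.update_self, Finset.sum_sub_distrib, Finset.sum_const,
    Finset.card_univ, Fintype.card_fin]
  rw [← Nat.cast_smul_eq_nsmul ℝ, smul_smul, mul_one_div_cancel hm', one_smul, sub_self]

lemma Ignores.deviation {κ κ' : ι} (hne : κ ≠ κ') {h : (ι → Fin m) → Fin m → E}
    (hh : Ignores κ h) : Ignores κ (deviation κ' h) := by
  intro σ j
  simp only [GTSarah.deviation, hh σ, Function.update_of_ne hne.symm]

variable [Fintype ι]

/-- Resampling one coordinate preserves the uniform law: exchanging the fresh value with the old one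
is an involution of the pairs `(σ, j)`. This is the substitute for conditioning on the other
coordinates. -/
lemma expect_update (hm : 1 ≤ m) (κ : ι) (g : (ι → Fin m) → ℝ) :
    𝔼 σ, g σ = 𝔼 σ : ι → Fin m, 𝔼 j : Fin m, g (Function.update σ κ j) := by
  have : NeZero m := ⟨by omega⟩
  have h1 : 𝔼 x : (ι → Fin m) × Fin m, g (Function.update x.1 κ x.2)
      = 𝔼 x : (ι → Fin m) × Fin m, g x.1 := by
    refine Finset.expect_nbij' (fun x => (Function.update x.1 κ x.2, x.1 κ))
      (fun x => (Function.update x.1 κ x.2, x.1 κ)) ?_ ?_ ?_ ?_ ?_ <;> simp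
  have h2 := Finset.expect_product (Finset.univ : Finset (ι → Fin m))
    (Finset.univ : Finset (Fin m)) (fun x => g (Function.update x.1 κ x.2))
  have h3 := Finset.expect_product (Finset.univ : Finset (ι → Fin m))
    (Finset.univ : Finset (Fin m)) (fun x => g x.1)
  rw [Finset.univ_product_univ] at h2 h3
  rw [← h2, h1, h3]
  simp only [Fintype.expect_const]

lemma expect_average (g : Fin m → ℝ) : 𝔼 j, g j = (1 / (m : ℝ)) * ∑ j, g j := by
  rw [Fintype.expect_eq_sum_div_card, Fintype.card_fin]
  ring

lemma expect_inner_eq_zero (hm : 1 ≤ m) {κ : ι} {A ξ : (ι → Fin m) → E} (hA : Ignores κ A)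
    (hξ : Centered κ ξ) : 𝔼 σ, inner ℝ (A σ) (ξ σ) = 0 := by
  rw [expect_update hm κ]
  refine Finset.expect_eq_zero fun σ _ => ?_
  rw [expect_average]
  simp only [hA σ]
  rw [← inner_sum, hξ σ, inner_zero_right, mul_zero]

lemma expect_norm_add_sq (hm : 1 ≤ m) {κ : ι} {A ξ : (ι → Fin m) → E} (hA : Ignores κ A)
    (hξ : Centered κ ξ) :
    𝔼 σ, ‖A σ + ξ σ‖ ^ 2 = 𝔼 σ, ‖A σ‖ ^ 2 + 𝔼 σ, ‖ξ σ‖ ^ 2 := by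
  simp only [norm_add_sq_real, Finset.expect_add_distrib, ← Finset.mul_expect,
    expect_inner_eq_zero hm hA hξ, mul_zero, add_zero]

/-- Pythagoras for martingale-like increments. By induction, each new term is centered in a
coordinate that the partial sum before it ignores. -/
lemma expect_norm_add_sum_sq (hm : 1 ≤ m) {β : Type*} (s : Finset β) (κ : β → ι)
    {A : (ι → Fin m) → E} {ξ : β → (ι → Fin m) → E} (hA : ∀ b ∈ s, Ignores (κ b) A)
    (hξ : ∀ b ∈ s, Centered (κ b) (ξ b))
    (hne : ∀ b ∈ s, ∀ c ∈ s, b ≠ c → Ignores (κ b) (ξ c)) :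
    𝔼 σ, ‖A σ + ∑ b ∈ s, ξ b σ‖ ^ 2 = 𝔼 σ, ‖A σ‖ ^ 2 + ∑ b ∈ s, 𝔼 σ, ‖ξ b σ‖ ^ 2 := by
  classical
  induction s using Finset.induction_on with
  | empty => simp
  | insert b s hb ih =>
    have ih' := ih (fun c hc => hA c (Finset.mem_insert_of_mem hc))
      (fun c hc => hξ c (Finset.mem_insert_of_mem hc))
      (fun c hc d hd => hne c (Finset.mem_insert_of_mem hc) d (Finset.mem_insert_of_mem hd))
    have hI : Ignores (κ b) fun σ => A σ + ∑ c ∈ s, ξ c σ := by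
      intro σ j
      simp only [hA b (Finset.mem_insert_self b s) σ j]
      congr 1
      refine Finset.sum_congr rfl fun c hc => ?_
      exact hne b (Finset.mem_insert_self b s) c (Finset.mem_insert_of_mem hc)
        (fun h => hb (h ▸ hc)) σ j
    have h := expect_norm_add_sq hm hI (hξ b (Finset.mem_insert_self b s))
    simp only [Finset.sum_insert hb]
    rw [ih'] at h
    have h2 : ∀ σ, A σ + (ξ b σ + ∑ c ∈ s, ξ c σ) = A σ + ∑ c ∈ s, ξ c σ + ξ b σ := fun σ => by
      abel
    simp only [h2, h]
    ring

lemma expect_sampled (hm : 1 ≤ m) {κ : ι} {g : (ι → Fin m) → Fin m → ℝ} (hg : Ignores κ g) :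
    𝔼 σ, g σ (σ κ) = 𝔼 σ : ι → Fin m, (1 / (m : ℝ)) * ∑ j, g σ j := by
  rw [expect_update hm κ]
  refine Finset.expect_congr rfl fun σ _ => ?_
  rw [expect_average]
  simp only [hg σ, Function.update_self]

/-- Variance is at most the second moment: the sampled value splits orthogonally into its average
and its deviation. -/
lemma expect_norm_deviation_sq_le (hm : 1 ≤ m) {κ : ι} {h : (ι → Fin m) → Fin m → E}
    (hh : Ignores κ h) :
    𝔼 σ, ‖deviation κ h σ‖ ^ 2 ≤ 𝔼 σ : ι → Fin m, (1 / (m : ℝ)) * ∑ j, ‖h σ j‖ ^ 2 := by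
  have hI : Ignores κ fun σ => (1 / (m : ℝ)) • ∑ j, h σ j := fun σ j => by simp only [hh σ j]
  have h1 := expect_norm_add_sq hm hI (centered_deviation hm hh)
  simp only [deviation, add_sub_cancel] at h1
  have h2 := expect_sampled hm (κ := κ) (g := fun σ j => ‖h σ j‖ ^ 2)
    fun σ j => by simp only [hh σ j]
  rw [← h2, h1]
  simp only [deviation]
  exact le_add_of_nonneg_left (Finset.expect_nonneg fun σ _ => sq_nonneg _)

end UniformAverage

/-! ### The run on a single time axis, and its pathwise inequalities. -/

section Trajectory

variable {n m p B : ℕ}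

/-- The states on one time axis: time `k` is step `k % (q + 1)` of outer iteration number
`k / (q + 1) + 1`, and `θ k` holds the indices sampled at that step. -/
def flatState (f : Fin n → Fin m → Vec p → ℝ) (W : Matrix (Fin n) (Fin n) ℝ) (α : ℝ) (q : ℕ)
    (x₀ : Vec p) (θ : ℕ → Fin n → Fin B → Fin m) : ℕ → State n p
  | 0 => { x := fun _ => x₀, xPrev := fun _ => x₀, y := fun _ => 0, v := fun _ => 0 }
  | k + 1 => step f W α (k % (q + 1)) (θ k) (flatState f W α q x₀ θ k)

variable (f : Fin n → Fin m → Vec p → ℝ) (W : Matrix (Fin n) (Fin n) ℝ) (α : ℝ) (q : ℕ)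
  (x₀ : Vec p)

lemma innerState_eq_flatState_of_eq (τ : ℕ → ℕ → Fin n → Fin B → Fin m) (s : ℕ) {z : State n p}
    (hz : z = flatState f W α q x₀ (fun k => τ (k / (q + 1)) (k % (q + 1))) (s * (q + 1))) :
    ∀ t ≤ q + 1, innerState f W α (τ s) z t
      = flatState f W α q x₀ (fun k => τ (k / (q + 1)) (k % (q + 1))) (s * (q + 1) + t) := by
  intro t
  induction t with
  | zero => intro _; exact hz
  | succ t ih =>
    intro ht
    have h1 : (s * (q + 1) + t) % (q + 1) = t := by
      rw [mul_comm, Nat.mul_add_mod, Nat.mod_eq_of_lt (by omega)]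
    have h2 : (s * (q + 1) + t) / (q + 1) = s := by
      rw [mul_comm, Nat.mul_add_div (by omega), Nat.div_eq_of_lt (by omega), add_zero]
    rw [← add_assoc, innerState, flatState, ih (by omega), h1, h2]

lemma outerState_eq_flatState (τ : ℕ → ℕ → Fin n → Fin B → Fin m) (s : ℕ) :
    outerState f W α q x₀ τ s
      = flatState f W α q x₀ (fun k => τ (k / (q + 1)) (k % (q + 1))) (s * (q + 1)) := by
  induction s with
  | zero => simp [outerState, flatState]
  | succ s ih =>
    rw [outerState, innerState_eq_flatState_of_eq f W α q x₀ τ s ih (q + 1) le_rfl, Nat.succ_mul]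

lemma iterate_eq_flatState (τ : ℕ → ℕ → Fin n → Fin B → Fin m) (s : ℕ) {t : ℕ} (ht : t ≤ q) :
    iterate f W α q x₀ τ s t
      = (flatState f W α q x₀ (fun k => τ (k / (q + 1)) (k % (q + 1))) (s * (q + 1) + t)).x := by
  funext i
  rw [iterate, innerState_eq_flatState_of_eq f W α q x₀ τ s
    (outerState_eq_flatState f W α q x₀ τ s) t (by omega)]

variable {f W α q x₀}

/-- A batch step reads no sample, so values at multiples of `q + 1` are irrelevant. This makes the
default value of `sampler` harmless. -/
lemma flatState_congr {θ θ' : ℕ → Fin n → Fin B → Fin m} {k : ℕ}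
    (h : ∀ k' < k, k' % (q + 1) ≠ 0 → θ k' = θ' k') :
    flatState f W α q x₀ θ k = flatState f W α q x₀ θ' k := by
  induction k with
  | zero => rfl
  | succ k ih =>
    rw [flatState, flatState, ih fun k' hk' => h k' (by omega)]
    by_cases hk : k % (q + 1) = 0
    · have he : ∀ z : State n p, estimator f 0 (θ k) z = estimator f 0 (θ' k) z := fun z => by
        funext i; simp only [estimator, if_true]
      simp only [step, hk, he]
    · rw [h k (by omega) hk]

variable {θ : ℕ → Fin n → Fin B → Fin m}

lemma flatState_succ_x (k : ℕ) (i : Fin n) :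
    (flatState f W α q x₀ θ (k + 1)).x i = mix W (flatState f W α q x₀ θ k).x i
      - α • (flatState f W α q x₀ θ (k + 1)).y i := rfl

lemma flatState_succ_xPrev (k : ℕ) :
    (flatState f W α q x₀ θ (k + 1)).xPrev = (flatState f W α q x₀ θ k).x := rfl

lemma flatState_succ_y (k : ℕ) (i : Fin n) :
    (flatState f W α q x₀ θ (k + 1)).y i = mix W (flatState f W α q x₀ θ k).y i
      + ((flatState f W α q x₀ θ (k + 1)).v i - (flatState f W α q x₀ θ k).v i) :=
  add_sub_assoc _ _ _

lemma flatState_succ_v (k : ℕ) :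
    (flatState f W α q x₀ θ (k + 1)).v
      = estimator f (k % (q + 1)) (θ k) (flatState f W α q x₀ θ k) := rfl

lemma flatState_succ_v_of_mod_eq_zero {L : ℝ} (hf : SmoothCosts f L) {k : ℕ}
    (hk : k % (q + 1) = 0) (i : Fin n) :
    (flatState f W α q x₀ θ (k + 1)).v i
      = gradient (localCost f i) ((flatState f W α q x₀ θ k).x i) := by
  rw [flatState_succ_v, estimator, if_pos hk, hf.gradient_localCost]

lemma flatState_succ_v_of_mod_ne_zero {k : ℕ} (hk : (k + 1) % (q + 1) ≠ 0) (i : Fin n) :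
    (flatState f W α q x₀ θ (k + 1 + 1)).v i
      = (1 / (B : ℝ)) • ∑ l,
          (gradient (f i (θ (k + 1) i l)) ((flatState f W α q x₀ θ (k + 1)).x i)
            - gradient (f i (θ (k + 1) i l)) ((flatState f W α q x₀ θ k).x i))
        + (flatState f W α q x₀ θ (k + 1)).v i := by
  rw [flatState_succ_v, estimator, if_neg hk, flatState_succ_xPrev]

variable (f W α q x₀ θ) in
-- The gradient-tracking invariant: both means start at zero, and each tracking update adds the same
-- increment to both.
lemma nodeMean_y_eq_nodeMean_v (hW : W ∈ doublyStochastic ℝ (Fin n)) (k : ℕ) :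
    nodeMean (flatState f W α q x₀ θ k).y = nodeMean (flatState f W α q x₀ θ k).v := by
  induction k with
  | zero => rfl
  | succ k ih =>
    rw [funext (flatState_succ_y k), nodeMean_add, nodeMean_sub, nodeMean_mix hW, ih]
    abel

variable (f W α q x₀ θ) in
lemma nodeMean_x_succ (hW : W ∈ doublyStochastic ℝ (Fin n)) (k : ℕ) :
    nodeMean (flatState f W α q x₀ θ (k + 1)).x = nodeMean (flatState f W α q x₀ θ k).x
      - α • nodeMean (flatState f W α q x₀ θ (k + 1)).v := by
  rw [funext (flatState_succ_x k), nodeMean_sub, nodeMean_smul, nodeMean_mix hW,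
    nodeMean_y_eq_nodeMean_v f W α q x₀ θ hW]

variable (f W α q x₀ θ) in
lemma disagreement_x_succ_le (hn : 1 ≤ n) (hW : NetworkWeights W) (k : ℕ) :
    disagreement (flatState f W α q x₀ θ (k + 1)).x
      ≤ netLambda W * disagreement (flatState f W α q x₀ θ k).x
        + 2 / (1 - netLambda W) * (α ^ 2 * disagreement (flatState f W α q x₀ θ (k + 1)).y) := by
  have h := disagreement_mix_add_le hn hW (flatState f W α q x₀ θ k).x
    (fun i => (-α) • (flatState f W α q x₀ θ (k + 1)).y i)
  rw [disagreement_smul, neg_sq] at h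
  rw [funext (flatState_succ_x k)]
  simpa only [neg_smul, ← sub_eq_add_neg] using h

variable (f W α q x₀ θ) in
lemma disagreement_y_succ_le (hn : 1 ≤ n) (hW : NetworkWeights W) (k : ℕ) :
    disagreement (flatState f W α q x₀ θ (k + 1)).y
      ≤ netLambda W * disagreement (flatState f W α q x₀ θ k).y
        + 2 / (1 - netLambda W)
          * ∑ i, ‖(flatState f W α q x₀ θ (k + 1)).v i - (flatState f W α q x₀ θ k).v i‖ ^ 2 := by
  rw [funext (flatState_succ_y k)]
  refine (disagreement_mix_add_le hn hW _ _).trans ?_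
  have := netLambda_lt_one hn hW
  exact add_le_add_right (mul_le_mul_of_nonneg_left (disagreement_le hn _)
    (div_nonneg zero_le_two (by linarith))) _

/-- Tracker and estimator start at zero, so the first tracker is the local gradient at `x₀`. This is
the source of the gradient term in `initialGap`. -/
lemma disagreement_y_one_le {L : ℝ} (hf : SmoothCosts f L) (hn : 1 ≤ n) :
    disagreement (flatState f W α q x₀ θ 1).y ≤ ∑ i, ‖gradient (localCost f i) x₀‖ ^ 2 := by
  have h : ∀ i, (flatState f W α q x₀ θ 1).y i = gradient (localCost f i) x₀ := by
    intro i
    rw [flatState_succ_y, flatState_succ_v_of_mod_eq_zero hf (Nat.zero_mod _)]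
    simp [flatState, mix]
  rw [funext h]
  exact disagreement_le hn _

variable (f W α q x₀ θ) in
-- A node's displacement is its new deviation, minus its old one, plus the movement `-α v̄` of the
-- mean.
lemma sum_norm_x_succ_sub_sq_le (hW : W ∈ doublyStochastic ℝ (Fin n)) (k : ℕ) :
    ∑ i, ‖(flatState f W α q x₀ θ (k + 1)).x i - (flatState f W α q x₀ θ k).x i‖ ^ 2
      ≤ 3 * disagreement (flatState f W α q x₀ θ (k + 1)).x
        + 3 * disagreement (flatState f W α q x₀ θ k).x
        + 3 * n * α ^ 2 * ‖nodeMean (flatState f W α q x₀ θ (k + 1)).v‖ ^ 2 := by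
  set z := flatState f W α q x₀ θ k
  set z' := flatState f W α q x₀ θ (k + 1)
  have hm : nodeMean z'.x - nodeMean z.x = -(α • nodeMean z'.v) := by
    rw [nodeMean_x_succ f W α q x₀ θ hW k]; abel
  have h : ∀ i, ‖z'.x i - z.x i‖ ^ 2 ≤ 3 * ‖z'.x i - nodeMean z'.x‖ ^ 2
      + 3 * ‖z.x i - nodeMean z.x‖ ^ 2 + 3 * (α ^ 2 * ‖nodeMean z'.v‖ ^ 2) := by
    intro i
    have h1 : z'.x i - z.x i = (z'.x i - nodeMean z'.x) + -(z.x i - nodeMean z.x)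
        + (nodeMean z'.x - nodeMean z.x) := by abel
    have h2 := norm_add₃_le (a := z'.x i - nodeMean z'.x) (b := -(z.x i - nodeMean z.x))
      (c := nodeMean z'.x - nodeMean z.x)
    rw [← h1, norm_neg, hm, norm_neg, norm_smul] at h2
    have h3 := pow_le_pow_left₀ (norm_nonneg _) h2 2
    have h4 : α ^ 2 * ‖nodeMean z'.v‖ ^ 2 = (‖α‖ * ‖nodeMean z'.v‖) ^ 2 := by
      rw [mul_pow, Real.norm_eq_abs, sq_abs]
    rw [h4]
    refine h3.trans ?_
    generalize ‖z'.x i - nodeMean z'.x‖ = a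
    generalize ‖z.x i - nodeMean z.x‖ = b
    generalize ‖α‖ * ‖nodeMean z'.v‖ = c
    nlinarith [sq_nonneg (a - b), sq_nonneg (b - c), sq_nonneg (a - c)]
  refine (Finset.sum_le_sum fun i _ => h i).trans (le_of_eq ?_)
  simp only [Finset.sum_add_distrib, ← Finset.mul_sum, Finset.sum_const, Finset.card_univ,
    Fintype.card_fin, nsmul_eq_mul, disagreement]
  ring

variable (W α q x₀ θ) in
-- The direction `v̄` misses the gradient at the mean iterate in two ways: the estimators err at the
-- nodes' own points, and those points differ from their mean.
lemma globalCost_nodeMean_succ_le {L : ℝ} (hf : SmoothCosts f L) (hn : 1 ≤ n)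
    (hW : W ∈ doublyStochastic ℝ (Fin n)) (hα : 0 ≤ α) (k : ℕ) :
    globalCost f (nodeMean (flatState f W α q x₀ θ (k + 1)).x)
      ≤ globalCost f (nodeMean (flatState f W α q x₀ θ k).x)
        - α / 2 * ‖gradient (globalCost f) (nodeMean (flatState f W α q x₀ θ k).x)‖ ^ 2
        - α / 2 * (1 - L * α) * ‖nodeMean (flatState f W α q x₀ θ (k + 1)).v‖ ^ 2
        + α * ‖nodeMean fun i => (flatState f W α q x₀ θ (k + 1)).v i
            - gradient (localCost f i) ((flatState f W α q x₀ θ k).x i)‖ ^ 2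
        + α * (L ^ 2 / n * disagreement (flatState f W α q x₀ θ k).x) := by
  rw [nodeMean_x_succ f W α q x₀ θ hW k]
  refine (hf.globalCost_sub_smul_le hn _ _).trans ?_
  set x := (flatState f W α q x₀ θ k).x
  set v := (flatState f W α q x₀ θ (k + 1)).v
  set xb := nodeMean x with hxb
  have h1 := norm_add_sq_le_of_pos one_pos
    (nodeMean v - nodeMean fun i => gradient (localCost f i) (x i))
    ((nodeMean fun i => gradient (localCost f i) (x i)) - gradient (globalCost f) xb)
  rw [sub_add_sub_cancel, ← nodeMean_sub] at h1
  have h2 := hf.norm_nodeMean_gradient_sub_sq_le x (fun _ => xb)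
  rw [← hf.gradient_globalCost] at h2
  have h3 : L ^ 2 * ((1 / (n : ℝ)) * ∑ i, ‖x i - xb‖ ^ 2) = L ^ 2 / n * disagreement x := by
    rw [disagreement, hxb]; ring
  rw [h3] at h2
  have h4 := mul_le_mul_of_nonneg_left
    (h1.trans (add_le_add_right (mul_le_mul_of_nonneg_left h2 (by norm_num)) _))
    (div_nonneg hα zero_le_two)
  linarith

end Trajectory

/-! ### Variance of the recursive gradient estimators. -/

section ExpectedError

open scoped BigOperators

variable {n m p B q K : ℕ}

/-- The sampled coordinates among the first `K` steps. -/
abbrev SampleIndex (n B q K : ℕ) := {k : Fin K // (k : ℕ) % (q + 1) ≠ 0} × Fin n × Fin B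

/-- The sequence of samples given by finitely many coordinates; the others are set to `j₀`. -/
def sampler (j₀ : Fin m) (σ : SampleIndex n B q K → Fin m) (k : ℕ) (i : Fin n) (l : Fin B) :
    Fin m :=
  if h : k < K ∧ k % (q + 1) ≠ 0 then σ (⟨⟨k, h.1⟩, h.2⟩, i, l) else j₀

variable {f : Fin n → Fin m → Vec p → ℝ} {W : Matrix (Fin n) (Fin n) ℝ} {α : ℝ} {x₀ : Vec p}
  {j₀ : Fin m}

/-- Adaptedness: the state on entering step `k` has used only samples from steps before `k`. -/
lemma ignores_flatState (κ : SampleIndex n B q K) {k : ℕ} (hk : k ≤ κ.1.1) :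
    Ignores κ fun σ => flatState f W α q x₀ (sampler j₀ σ) k := by
  intro σ j
  refine flatState_congr fun k' hk' _ => ?_
  funext i l
  unfold sampler
  split_ifs with h
  · refine Function.update_of_ne (fun he => ?_) _ _
    have : k' = κ.1.1 := by rw [← he]
    omega
  · rfl

/-- The change of the component gradient `∇f_{i,j}` at node `i` between the times `k` and
`k + 1`. -/
def gradientIncrement (f : Fin n → Fin m → Vec p → ℝ) (W : Matrix (Fin n) (Fin n) ℝ) (α : ℝ)
    (x₀ : Vec p) (j₀ : Fin m) (k : ℕ) (i : Fin n) (σ : SampleIndex n B q K → Fin m) (j : Fin m) :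
    Vec p :=
  gradient (f i j) ((flatState f W α q x₀ (sampler j₀ σ) (k + 1)).x i)
    - gradient (f i j) ((flatState f W α q x₀ (sampler j₀ σ) k).x i)

lemma ignores_gradientIncrement (κ : SampleIndex n B q K) {k : ℕ} (hk : k + 1 ≤ κ.1.1)
    (i : Fin n) : Ignores κ (gradientIncrement f W α x₀ j₀ k i) := by
  intro σ j
  funext j'
  simp only [gradientIncrement,
    ignores_flatState (f := f) (W := W) (α := α) (x₀ := x₀) (j₀ := j₀) κ hk σ j,
    ignores_flatState (f := f) (W := W) (α := α) (x₀ := x₀) (j₀ := j₀) κ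
      (Nat.le_of_succ_le hk) σ j]

lemma average_gradientIncrement {L : ℝ} (hf : SmoothCosts f L) (k : ℕ) (i : Fin n)
    (σ : SampleIndex n B q K → Fin m) :
    (1 / (m : ℝ)) • ∑ j, gradientIncrement f W α x₀ j₀ k i σ j
      = gradient (localCost f i) ((flatState f W α q x₀ (sampler j₀ σ) (k + 1)).x i)
        - gradient (localCost f i) ((flatState f W α q x₀ (sampler j₀ σ) k).x i) := by
  rw [hf.gradient_localCost, hf.gradient_localCost, ← smul_sub, ← Finset.sum_sub_distrib]
  rfl

lemma expect_average_gradientIncrement_sq_le {L : ℝ} (hf : SmoothCosts f L) (k : ℕ) (i : Fin n) :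
    𝔼 σ : SampleIndex n B q K → Fin m,
        (1 / (m : ℝ)) * ∑ j, ‖gradientIncrement f W α x₀ j₀ k i σ j‖ ^ 2
      ≤ L ^ 2 * 𝔼 σ : SampleIndex n B q K → Fin m,
        ‖(flatState f W α q x₀ (sampler j₀ σ) (k + 1)).x i
          - (flatState f W α q x₀ (sampler j₀ σ) k).x i‖ ^ 2 := by
  rw [Finset.mul_expect]
  exact Finset.expect_le_expect fun σ _ => hf.mean_square_smooth i _ _

lemma sampler_of_lt (σ : SampleIndex n B q K → Fin m) {k : ℕ} (hk : k < K)
    (hk' : k % (q + 1) ≠ 0) (i : Fin n) (l : Fin B) :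
    sampler j₀ σ k i l = σ (⟨⟨k, hk⟩, hk'⟩, i, l) := dif_pos ⟨hk, hk'⟩

/-- Within an outer iteration, the change of the estimator is bounded by the displacement. -/
lemma expect_norm_v_succ_sub_sq_le {L : ℝ} (hf : SmoothCosts f L) {k : ℕ}
    (hk : k + 1 < K) (hk' : (k + 1) % (q + 1) ≠ 0) (i : Fin n) :
    𝔼 σ : SampleIndex n B q K → Fin m,
        ‖(flatState f W α q x₀ (sampler j₀ σ) (k + 1 + 1)).v i
          - (flatState f W α q x₀ (sampler j₀ σ) (k + 1)).v i‖ ^ 2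
      ≤ L ^ 2 * 𝔼 σ : SampleIndex n B q K → Fin m,
        ‖(flatState f W α q x₀ (sampler j₀ σ) (k + 1)).x i
          - (flatState f W α q x₀ (sampler j₀ σ) k).x i‖ ^ 2 := by
  have hm : 1 ≤ m := Nat.one_le_of_lt j₀.2
  set d := L ^ 2 * 𝔼 σ : SampleIndex n B q K → Fin m,
        ‖(flatState f W α q x₀ (sampler j₀ σ) (k + 1)).x i
          - (flatState f W α q x₀ (sampler j₀ σ) k).x i‖ ^ 2 with hd
  have hd0 : 0 ≤ d := mul_nonneg (sq_nonneg _) (Finset.expect_nonneg fun _ _ => sq_nonneg _)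
  have h1 : ∀ l : Fin B, 𝔼 σ : SampleIndex n B q K → Fin m,
      ‖gradientIncrement f W α x₀ j₀ k i σ (σ (⟨⟨k + 1, hk⟩, hk'⟩, i, l))‖ ^ 2 ≤ d := by
    intro l
    rw [expect_sampled hm (κ := ((⟨⟨k + 1, hk⟩, hk'⟩, i, l) : SampleIndex n B q K))
      (g := fun σ j => ‖gradientIncrement f W α x₀ j₀ k i σ j‖ ^ 2) ?_]
    · exact expect_average_gradientIncrement_sq_le hf k i
    · intro σ j
      simp only [ignores_gradientIncrement (f := f) (W := W) (α := α) (x₀ := x₀) (j₀ := j₀)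
        ((⟨⟨k + 1, hk⟩, hk'⟩, i, l) : SampleIndex n B q K) le_rfl i σ j]
  calc _ ≤ 𝔼 σ : SampleIndex n B q K → Fin m, (1 / (B : ℝ)) *
        ∑ l, ‖gradientIncrement f W α x₀ j₀ k i σ (σ (⟨⟨k + 1, hk⟩, hk'⟩, i, l))‖ ^ 2 := by
        refine Finset.expect_le_expect fun σ _ => ?_
        rw [flatState_succ_v_of_mod_ne_zero hk', add_sub_cancel_right]
        simp only [sampler_of_lt σ hk hk']
        exact norm_average_sq_le _
    _ = (1 / (B : ℝ)) * ∑ l : Fin B, 𝔼 σ : SampleIndex n B q K → Fin m,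
          ‖gradientIncrement f W α x₀ j₀ k i σ (σ (⟨⟨k + 1, hk⟩, hk'⟩, i, l))‖ ^ 2 := by
        rw [← Finset.mul_expect, Finset.expect_sum_comm]
    _ ≤ (1 / (B : ℝ)) * ∑ _l : Fin B, d :=
        mul_le_mul_of_nonneg_left (Finset.sum_le_sum fun l _ => h1 l) (by positivity)
    _ ≤ d := by
        rw [Finset.sum_const, Finset.card_univ, Fintype.card_fin, nsmul_eq_mul, ← mul_assoc,
          one_div]
        exact mul_le_of_le_one_left hd0 (inv_mul_le_one (a := (B : ℝ)))

/-- The error of the estimator of node `i` at time `k`. -/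
def estimatorError (f : Fin n → Fin m → Vec p → ℝ) (W : Matrix (Fin n) (Fin n) ℝ) (α : ℝ)
    (q : ℕ) (x₀ : Vec p) (θ : ℕ → Fin n → Fin B → Fin m) (k : ℕ) (i : Fin n) : Vec p :=
  (flatState f W α q x₀ θ (k + 1)).v i
    - gradient (localCost f i) ((flatState f W α q x₀ θ k).x i)

lemma estimatorError_of_mod_eq_zero {L : ℝ} (hf : SmoothCosts f L)
    {θ : ℕ → Fin n → Fin B → Fin m} {k : ℕ} (hk : k % (q + 1) = 0) (i : Fin n) :
    estimatorError f W α q x₀ θ k i = 0 := by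
  rw [estimatorError, flatState_succ_v_of_mod_eq_zero hf hk, sub_self]

/-- The sampled increment and the true gradient increment have the same conditional mean, so the
error changes only by centered deviations, one per minibatch sample. -/
lemma estimatorError_succ {L : ℝ} (hf : SmoothCosts f L) (hB : 1 ≤ B)
    (σ : SampleIndex n B q K → Fin m) {k : ℕ}
    (hk : k + 1 < K) (hk' : (k + 1) % (q + 1) ≠ 0) (i : Fin n) :
    estimatorError f W α q x₀ (sampler j₀ σ) (k + 1) i
      = estimatorError f W α q x₀ (sampler j₀ σ) k i
        + ∑ l, (1 / (B : ℝ)) • deviation (⟨⟨k + 1, hk⟩, hk'⟩, i, l)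
            (gradientIncrement f W α x₀ j₀ k i) σ := by
  have hB' : (B : ℝ) ≠ 0 := by positivity
  simp only [deviation, average_gradientIncrement hf, ← Finset.smul_sum, Finset.sum_sub_distrib,
    Finset.sum_const, Finset.card_univ, Fintype.card_fin, smul_sub]
  rw [← Nat.cast_smul_eq_nsmul ℝ B, ← Nat.cast_smul_eq_nsmul ℝ B, smul_smul, smul_smul,
    one_div_mul_cancel hB', one_smul, one_smul]
  simp only [estimatorError, flatState_succ_v_of_mod_ne_zero hk', sampler_of_lt σ hk hk',
    gradientIncrement]
  abel

/-- Growth of the error of a linear combination of the estimators, within an outer iteration. The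
samples of different nodes and of the same minibatch contribute independently. -/
lemma expect_norm_sum_estimatorError_sq_le {L : ℝ} (hf : SmoothCosts f L) (hB : 1 ≤ B)
    (c : Fin n → ℝ) {k : ℕ} (hk : k + 1 < K) (hk' : (k + 1) % (q + 1) ≠ 0) :
    𝔼 σ : SampleIndex n B q K → Fin m,
        ‖∑ i, c i • estimatorError f W α q x₀ (sampler j₀ σ) (k + 1) i‖ ^ 2
      ≤ 𝔼 σ : SampleIndex n B q K → Fin m,
          ‖∑ i, c i • estimatorError f W α q x₀ (sampler j₀ σ) k i‖ ^ 2
        + L ^ 2 / B * ∑ i, c i ^ 2 * 𝔼 σ : SampleIndex n B q K → Fin m,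
            ‖(flatState f W α q x₀ (sampler j₀ σ) (k + 1)).x i
              - (flatState f W α q x₀ (sampler j₀ σ) k).x i‖ ^ 2 := by
  have hm : 1 ≤ m := Nat.one_le_of_lt j₀.2
  have hB' : (0 : ℝ) < B := by positivity
  let κ : Fin n × Fin B → SampleIndex n B q K := fun b => (⟨⟨k + 1, hk⟩, hk'⟩, b)
  have hκ : ∀ b c, b ≠ c → κ b ≠ κ c := fun b c hbc he => hbc (Prod.ext_iff.1 he).2
  let ξ : Fin n × Fin B → (SampleIndex n B q K → Fin m) → Vec p := fun b σ =>
    (c b.1 * (1 / (B : ℝ))) • deviation (κ b) (gradientIncrement f W α x₀ j₀ k b.1) σ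
  have hsplit : ∀ σ : SampleIndex n B q K → Fin m,
      ∑ i, c i • estimatorError f W α q x₀ (sampler j₀ σ) (k + 1) i
        = ∑ i, c i • estimatorError f W α q x₀ (sampler j₀ σ) k i + ∑ b, ξ b σ := by
    intro σ
    simp only [estimatorError_succ hf hB σ hk hk', smul_add, Finset.sum_add_distrib,
      Finset.smul_sum, smul_smul]
    rw [Fintype.sum_prod_type]
  have hA : ∀ b ∈ Finset.univ, Ignores (κ b) fun σ : SampleIndex n B q K → Fin m =>
      ∑ i, c i • estimatorError f W α q x₀ (sampler j₀ σ) k i := by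
    intro b _ σ j
    simp only [estimatorError,
      ignores_flatState (f := f) (W := W) (α := α) (x₀ := x₀) (j₀ := j₀) (κ b)
        (k := k + 1) le_rfl σ j,
      ignores_flatState (f := f) (W := W) (α := α) (x₀ := x₀) (j₀ := j₀) (κ b)
        (Nat.le_succ k) σ j]
  have hG : ∀ b i, Ignores (κ b) (gradientIncrement f W α x₀ j₀ k i) := fun b i =>
    ignores_gradientIncrement (κ b) le_rfl i
  have hξ : ∀ b ∈ Finset.univ, Centered (κ b) (ξ b) := by
    intro b _ σ
    simp only [ξ, ← Finset.smul_sum]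
    rw [centered_deviation hm (hG b b.1) σ, smul_zero]
  have hne : ∀ b ∈ Finset.univ, ∀ c ∈ Finset.univ, b ≠ c → Ignores (κ b) (ξ c) := by
    intro b _ b' _ hbb σ j
    simp only [ξ]
    rw [(hG b b'.1).deviation (hκ b b' hbb) σ j]
  simp only [hsplit]
  rw [expect_norm_add_sum_sq hm Finset.univ κ hA hξ hne]
  refine add_le_add_right ?_ _
  have hb : ∀ b, 𝔼 σ, ‖ξ b σ‖ ^ 2 ≤ (c b.1 / B) ^ 2 * (L ^ 2 *
      𝔼 σ : SampleIndex n B q K → Fin m, ‖(flatState f W α q x₀ (sampler j₀ σ) (k + 1)).x b.1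
              - (flatState f W α q x₀ (sampler j₀ σ) k).x b.1‖ ^ 2) := by
    intro b
    simp only [ξ, norm_smul, mul_pow _ ‖_‖, ← Finset.mul_expect, Real.norm_eq_abs, sq_abs,
      mul_one_div]
    exact mul_le_mul_of_nonneg_left ((expect_norm_deviation_sq_le hm (hG b b.1)).trans
      (expect_average_gradientIncrement_sq_le hf k b.1)) (by positivity)
  -- Summing the weight `(c i / B) ^ 2` over the `B` samples leaves `c i ^ 2 / B`, the minibatch
  -- gain.
  refine (Finset.sum_le_sum fun b _ => hb b).trans (le_of_eq ?_)
  rw [Fintype.sum_prod_type, Finset.mul_sum]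
  refine Finset.sum_congr rfl fun i _ => ?_
  simp only [Finset.sum_const, Finset.card_univ, Fintype.card_fin, nsmul_eq_mul]
  field_simp

end ExpectedError

/-! ### Summation of scalar recursions, and closing the coupled bounds. -/

section Recursions

/-- Sums of a sequence that is reset every `q + 1` steps and otherwise grows by `d`. -/
lemma sum_le_of_reset {a d : ℕ → ℝ} {q K : ℕ} (ha : ∀ k, 0 ≤ a k) (hd : ∀ k, 0 ≤ d k)
    (h0 : ∀ k, k % (q + 1) = 0 → a k = 0)
    (h1 : ∀ k, k + 1 < K → (k + 1) % (q + 1) ≠ 0 → a (k + 1) ≤ a k + d k) {N : ℕ} (hN : N < K) :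
    ∑ k ∈ Finset.range (N + 1), a k ≤ q * ∑ k ∈ Finset.range N, d k := by
  -- The stronger invariant prepays the steps left in the current outer iteration, during which `a
  -- N` can persist; thus each `d k` is charged at most `q` times.
  suffices h : ∑ k ∈ Finset.range (N + 1), a k + ((q : ℝ) - (N % (q + 1) : ℕ)) * a N
      ≤ q * ∑ k ∈ Finset.range N, d k by
    have h2 : N % (q + 1) ≤ q := Nat.le_of_lt_succ (Nat.mod_lt _ (Nat.succ_pos q))
    have h3 : ((N % (q + 1) : ℕ) : ℝ) ≤ q := by exact_mod_cast h2
    nlinarith [mul_nonneg (sub_nonneg.2 h3) (ha N)]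
  induction N with
  | zero => simp [h0 0 (Nat.zero_mod _)]
  | succ N ih =>
    have ih := ih (by omega)
    have h2 : N % (q + 1) ≤ q := Nat.le_of_lt_succ (Nat.mod_lt _ (Nat.succ_pos q))
    have h3 : ((N % (q + 1) : ℕ) : ℝ) ≤ q := by exact_mod_cast h2
    rw [Finset.sum_range_succ, Finset.sum_range_succ d, mul_add]
    by_cases hr : (N + 1) % (q + 1) = 0
    · rw [h0 _ hr]
      nlinarith [mul_nonneg (sub_nonneg.2 h3) (ha N), mul_nonneg (Nat.cast_nonneg (α := ℝ) q) (hd N)]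
    · have h4 : (N + 1) % (q + 1) = N % (q + 1) + 1 := by
        rcases Nat.eq_zero_or_pos q with rfl | hq
        · exact absurd (Nat.mod_one _) hr
        · rw [Nat.add_mod_eq_ite] at hr ⊢
          rw [Nat.mod_eq_of_lt (a := 1) (by omega)] at hr ⊢
          split_ifs at hr ⊢ with h5 <;> omega
      rw [h4]
      push_cast
      have h5 := mul_le_mul_of_nonneg_left (h1 N hN hr) (sub_nonneg.2 h3)
      nlinarith [mul_nonneg (Nat.cast_nonneg (α := ℝ) (N % (q + 1))) (hd N)]

/-- The values of such a sequence just before the resets. -/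
lemma sum_before_reset_le {a d : ℕ → ℝ} {q K : ℕ} (ha : ∀ k, 0 ≤ a k) (hd : ∀ k, 0 ≤ d k)
    (h0 : ∀ k, k % (q + 1) = 0 → a k = 0)
    (h1 : ∀ k, k + 1 < K → (k + 1) % (q + 1) ≠ 0 → a (k + 1) ≤ a k + d k) {N : ℕ} (hN : N < K) :
    ∑ k ∈ Finset.range N, (if (k + 1) % (q + 1) = 0 then a k else 0)
      ≤ ∑ k ∈ Finset.range N, d k := by
  -- Keeping the running value `a N` on the left makes a reset move it into the sum, so each `d k`
  -- is charged once.
  suffices h : ∑ k ∈ Finset.range N, (if (k + 1) % (q + 1) = 0 then a k else 0) + a N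
      ≤ ∑ k ∈ Finset.range N, d k by linarith [ha N]
  induction N with
  | zero => simp [h0 0 (Nat.zero_mod _)]
  | succ N ih =>
    have ih := ih (by omega)
    rw [Finset.sum_range_succ, Finset.sum_range_succ d]
    split_ifs with hr
    · rw [h0 _ hr]
      linarith [hd N]
    · linarith [h1 N hN hr]

lemma sum_le_of_contraction {a b : ℕ → ℝ} {l : ℝ} {N : ℕ} (hl : 0 ≤ l) (ha : ∀ k, 0 ≤ a k)
    (h : ∀ k < N, a (k + 1) ≤ l * a k + b k) :
    (1 - l) * ∑ k ∈ Finset.range (N + 1), a k ≤ a 0 + ∑ k ∈ Finset.range N, b k := by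
  suffices h' : (1 - l) * ∑ k ∈ Finset.range (N + 1), a k + l * a N
      ≤ a 0 + ∑ k ∈ Finset.range N, b k by
    linarith [mul_nonneg hl (ha N)]
  induction N with
  | zero => simp; linarith
  | succ N ih =>
    have ih := ih fun k hk => h k (by omega)
    rw [Finset.sum_range_succ, Finset.sum_range_succ b]
    linarith [h N (Nat.lt_succ_self N)]

/-- Resolution of the coupled bounds on the consensus error `c`, the displacement `ζ`, the
accumulated estimator error `s`, and the sums `G`, `w` of the squared gradients and directions.
Here `u = α L`, `g = 1 - λ`, and `ρ` bounds the variance accumulated in an outer iteration. -/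
lemma resolve_coupled_bounds {b c₂ u g ρ c ζ s G w G₀ Φ : ℝ}
    (hb : b * (14 * (1 + c₂)) = 1) (hb0 : 0 < b) (hc₂ : 0 < c₂) (hu : 0 < u) (hg : 0 < g)
    (hg1 : g ≤ 1) (hug : u ≤ b * g ^ 2) (hρ0 : 0 ≤ ρ) (hρ2 : ρ * u ^ 2 ≤ c₂ * b ^ 2)
    (hρ3 : ρ * u ^ 3 ≤ c₂ * b ^ 3 * g ^ 3) (hζ0 : 0 ≤ ζ)
    (hw : 0 ≤ w) (hG₀ : 0 ≤ G₀) (hΦ : 0 ≤ Φ)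
    (hc : c ≤ 2 * (u ^ 2 / g ^ 3) * G₀ + 16 * (u ^ 2 / g ^ 4) * ζ)
    (hζ : ζ ≤ 6 * c + 3 * u ^ 2 * w) (hs : s ≤ ρ * ζ)
    (hG : G + (1 - u) * w ≤ 2 * (Φ / u) + 2 * s + 2 * c) :
    2 * G + 3 * c ≤ 5 * ((Φ + G₀) / u) := by
  have hbl : b ≤ 1 / 14 := by nlinarith
  have hcb : c₂ * b ≤ 1 / 14 := by nlinarith
  have hcb2 : c₂ * b ^ 2 ≤ 1 / 196 := by
    calc c₂ * b ^ 2 = (c₂ * b) * b := by ring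
      _ ≤ (1 / 14) * (1 / 14) := mul_le_mul hcb hbl hb0.le (by norm_num)
      _ = _ := by norm_num
  have hb2 : b ^ 2 ≤ 1 / 196 := by
    calc b ^ 2 ≤ (1 / 14) ^ 2 := pow_le_pow_left₀ hb0.le hbl 2
      _ = _ := by norm_num
  have hb3 : b ^ 3 ≤ 1 / 2744 := by
    calc b ^ 3 ≤ (1 / 14) ^ 3 := pow_le_pow_left₀ hb0.le hbl 3
      _ = _ := by norm_num
  have hcb3 : c₂ * b ^ 3 ≤ 1 / 2744 := by
    calc c₂ * b ^ 3 = (c₂ * b ^ 2) * b := by ring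
      _ ≤ (1 / 196) * (1 / 14) := mul_le_mul hcb2 hbl hb0.le (by norm_num)
      _ = _ := by norm_num
  have hg2 : g ^ 2 ≤ 1 := pow_le_one₀ hg.le hg1
  have hub : u ≤ 1 / 14 := by nlinarith
  set Q := G₀ / u with hQ
  have hQ0 : 0 ≤ Q := div_nonneg hG₀ hu.le
  have hG₀Q : G₀ = u * Q := by rw [hQ]; field_simp
  have hu2 : u ^ 2 ≤ 1 / 196 := by
    calc u ^ 2 ≤ (1 / 14) ^ 2 := pow_le_pow_left₀ hu.le hub 2
      _ = _ := by norm_num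
  have hu4 : u ^ 2 / g ^ 4 ≤ 1 / 196 := by
    rw [div_le_iff₀ (by positivity)]
    calc u ^ 2 ≤ (b * g ^ 2) ^ 2 := pow_le_pow_left₀ hu.le hug 2
      _ = b ^ 2 * g ^ 4 := by ring
      _ ≤ 1 / 196 * g ^ 4 := mul_le_mul_of_nonneg_right hb2 (by positivity)
  set A := u ^ 2 / g ^ 3 * G₀ with hA
  have hA0 : 0 ≤ A := by positivity
  have hA1 : A ≤ 1 / 2744 * Q := by
    rw [hA, hG₀Q, ← mul_assoc]
    refine mul_le_mul_of_nonneg_right ?_ hQ0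
    rw [div_mul_eq_mul_div, div_le_iff₀ (by positivity)]
    calc u ^ 2 * u = u ^ 3 := by ring
      _ ≤ (b * g ^ 2) ^ 3 := pow_le_pow_left₀ hu.le hug 3
      _ = b ^ 3 * (g ^ 3 * g ^ 3) := by ring
      _ ≤ 1 / 2744 * (g ^ 3 * 1) :=
          mul_le_mul hb3 (mul_le_mul_of_nonneg_left (pow_le_one₀ hg.le hg1) (by positivity))
            (by positivity) (by norm_num)
      _ = _ := by ring
  -- The initial tracking disagreement also feeds the variance. Controlling it is the role of the
  -- cubic step-size condition.
  have hρA : ρ * A ≤ 1 / 2744 * Q := by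
    rw [hA, hG₀Q]
    have : ρ * (u ^ 2 / g ^ 3 * (u * Q)) = ρ * u ^ 3 / g ^ 3 * Q := by ring
    rw [this]
    refine mul_le_mul_of_nonneg_right ?_ hQ0
    rw [div_le_iff₀ (by positivity)]
    exact hρ3.trans (mul_le_mul_of_nonneg_right hcb3 (by positivity))
  have hc' : c ≤ 2 * A + 16 / 196 * ζ := by
    have := mul_le_mul_of_nonneg_right hu4 hζ0
    have e : 2 * (u ^ 2 / g ^ 3) * G₀ = 2 * A := by rw [hA]; ring
    rw [e] at hc
    linarith
  -- Substituting `hc'` into `hζ` gives `ζ` the coefficient `96/196 < 1/2` on the right, so it is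
  -- absorbed at the cost of a factor two.
  have hζ' : ζ ≤ 24 * A + 6 * (u ^ 2 * w) := by linarith [mul_nonneg (sq_nonneg u) hw]
  have hs' : s ≤ 24 / 2744 * Q + 6 / 196 * w := by
    have h1 := mul_le_mul_of_nonneg_left hζ' hρ0
    have h2 := mul_le_mul_of_nonneg_right (hρ2.trans hcb2) hw
    linarith
  have hw' := mul_le_mul_of_nonneg_right hu2 hw
  have hc'' : c ≤ 4 / 2744 * Q + 1 / 300 * w := by linarith
  have huw := mul_le_mul_of_nonneg_right hub hw
  set P := Φ / u with hP
  have hP0 : 0 ≤ P := div_nonneg hΦ hu.le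
  rw [add_div, ← hP, ← hQ]
  linarith

end Recursions

/-! ### Summing the coupled recursions along the run. -/

section Convergence

open scoped BigOperators

/-- The deterministic core. `C` and `D` stand for the disagreement of iterates and trackers, `U` for
estimator changes, `δ` for displacements, `e` and `e'` for mean and nodewise estimator errors, `G`
and `w` for squared gradients and directions, and `F` for the cost. The recursions under sampling
are needed only at times below `N + 1`. -/
lemma sum_le_of_recursions {n q B N : ℕ} {C D U δ e e' G w F : ℕ → ℝ}
    {l L α G₀ Fs b c₂ : ℝ} (hn : 1 ≤ n) (hL : 0 < L) (hα : 0 < α)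
    (hl0 : 0 ≤ l) (hl1 : l < 1) (hb : b * (14 * (1 + c₂)) = 1) (hb0 : 0 < b) (hc₂ : 0 < c₂)
    (hu1 : α * L ≤ b * (1 - l) ^ 2)
    (hu2 : (q : ℝ) / (n * B) * (α * L) ^ 2 ≤ c₂ * b ^ 2)
    (hu3 : (q : ℝ) / (n * B) * (α * L) ^ 3 ≤ c₂ * b ^ 3 * (1 - l) ^ 3)
    (hCn : ∀ k, 0 ≤ C k) (hDn : ∀ k, 0 ≤ D k) (hδn : ∀ k, 0 ≤ δ k) (hen : ∀ k, 0 ≤ e k)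
    (hen' : ∀ k, 0 ≤ e' k) (hwn : ∀ k, 0 ≤ w k) (hG₀ : 0 ≤ G₀)
    (hC0 : C 0 = 0) (hC : ∀ k, C (k + 1) ≤ l * C k + 2 / (1 - l) * (α ^ 2 * D (k + 1)))
    (hD1 : D 1 ≤ n * G₀) (hD : ∀ k, D (k + 1) ≤ l * D k + 2 / (1 - l) * U k)
    (hU : ∀ k, k + 1 < N + 1 → (k + 1) % (q + 1) ≠ 0 → U (k + 1) ≤ L ^ 2 * δ k)
    (hU0 : ∀ k, (k + 1) % (q + 1) = 0 → U (k + 1) ≤ 2 * (L ^ 2 * δ k) + 2 * e' k)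
    (he0 : ∀ k, k % (q + 1) = 0 → e k = 0)
    (he : ∀ k, k + 1 < N + 1 → (k + 1) % (q + 1) ≠ 0 →
      e (k + 1) ≤ e k + L ^ 2 / B * ((1 / (n : ℝ)) ^ 2 * δ k))
    (he0' : ∀ k, k % (q + 1) = 0 → e' k = 0)
    (he' : ∀ k, k + 1 < N + 1 → (k + 1) % (q + 1) ≠ 0 → e' (k + 1) ≤ e' k + L ^ 2 * δ k)
    (hδ : ∀ k, δ k ≤ 3 * C (k + 1) + 3 * C k + 3 * n * α ^ 2 * w k)
    (hF : ∀ k, F (k + 1) ≤ F k - α / 2 * G k - α / 2 * (1 - L * α) * w k + α * e k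
      + α * (L ^ 2 / n * C k)) (hFs : ∀ k, Fs ≤ F k) :
    2 * ∑ k ∈ Finset.range (N + 1), G k + 3 * (L ^ 2 / n * ∑ k ∈ Finset.range (N + 1), C k)
      ≤ 5 * ((L * (F 0 - Fs) + G₀) / (α * L)) := by
  have hn' : (0 : ℝ) < n := by exact_mod_cast hn
  have hg : 0 < 1 - l := by linarith
  set g := 1 - l with hgdef
  set Z := ∑ k ∈ Finset.range N, δ k with hZ
  set SC := ∑ k ∈ Finset.range (N + 1), C k with hSC
  set Sw := ∑ k ∈ Finset.range (N + 1), w k with hSw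
  set SG := ∑ k ∈ Finset.range (N + 1), G k with hSG
  have hZ0 : 0 ≤ Z := Finset.sum_nonneg fun k _ => hδn k
  have hSw0 : 0 ≤ Sw := Finset.sum_nonneg fun k _ => hwn k
  -- change of the estimators
  have hSU : ∑ k ∈ Finset.range N, U (k + 1) ≤ 4 * L ^ 2 * Z := by
    have h1 : ∀ k ∈ Finset.range N, U (k + 1)
        ≤ 2 * (L ^ 2 * δ k) + 2 * (if (k + 1) % (q + 1) = 0 then e' k else 0) := by
      intro k hk
      have hk' := Finset.mem_range.1 hk
      have h2 : 0 ≤ L ^ 2 * δ k := mul_nonneg (sq_nonneg L) (hδn k)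
      split_ifs with hr
      · exact hU0 k hr
      · have := hU k (by omega) hr
        linarith
    -- Errors discarded by batch steps are charged once to the displacements of their own outer
    -- iteration, so no factor `q` enters the tracking error.
    have h3 := sum_before_reset_le hen' (fun k => mul_nonneg (sq_nonneg L) (hδn k)) he0' he'
      (Nat.lt_succ_self N)
    rw [← Finset.mul_sum, ← hZ] at h3
    have h4 := Finset.sum_le_sum h1
    rw [Finset.sum_add_distrib, ← Finset.mul_sum, ← Finset.mul_sum, ← Finset.mul_sum, ← hZ] at h4
    linarith
  -- tracking error
  have hSD : g * ∑ k ∈ Finset.range N, D (k + 1) ≤ n * G₀ + 2 / g * (4 * L ^ 2 * Z) := by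
    -- The sequence is shifted by one because the initial bound concerns `D 1`, the first tracker.
    have h1 := sum_le_of_contraction (a := fun k => D (k + 1)) (b := fun k => 2 / g * U (k + 1))
      (N := N) hl0 (fun k => hDn _) fun k _ => hD (k + 1)
    rw [← Finset.mul_sum, Finset.sum_range_succ, zero_add, mul_add] at h1
    have h2 := mul_le_mul_of_nonneg_left hSU (div_nonneg zero_le_two hg.le)
    have h3 := mul_nonneg hg.le (hDn (N + 1))
    linarith
  -- consensus error
  have hSC1 : g * SC ≤ 2 / g * (α ^ 2 * ∑ k ∈ Finset.range N, D (k + 1)) := by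
    have h1 := sum_le_of_contraction (a := C) (b := fun k => 2 / g * (α ^ 2 * D (k + 1)))
      (N := N) hl0 hCn fun k _ => hC k
    rwa [hC0, zero_add, ← Finset.mul_sum, ← Finset.mul_sum] at h1
  have hSC2 : SC ≤ 2 * α ^ 2 / g ^ 3 * (n * G₀) + 16 * α ^ 2 * L ^ 2 / g ^ 4 * Z := by
    have h1 : SC ≤ 2 / g * (α ^ 2 * ∑ k ∈ Finset.range N, D (k + 1)) / g := by
      rw [le_div_iff₀ hg]; linarith
    have h2 : ∑ k ∈ Finset.range N, D (k + 1) ≤ (n * G₀ + 2 / g * (4 * L ^ 2 * Z)) / g := by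
      rw [le_div_iff₀ hg]; linarith
    calc SC ≤ 2 / g * (α ^ 2 * ∑ k ∈ Finset.range N, D (k + 1)) / g := h1
      _ ≤ 2 / g * (α ^ 2 * ((n * G₀ + 2 / g * (4 * L ^ 2 * Z)) / g)) / g := by gcongr
      _ = _ := by field_simp; ring
  have hZ1 : Z ≤ 6 * SC + 3 * n * α ^ 2 * Sw := by
    have h1 := Finset.sum_le_sum fun k (_ : k ∈ Finset.range N) => hδ k
    rw [Finset.sum_add_distrib, Finset.sum_add_distrib, ← Finset.mul_sum, ← Finset.mul_sum,
      ← Finset.mul_sum, ← hZ] at h1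
    have h2 : ∑ k ∈ Finset.range N, C k ≤ SC := by
      rw [hSC, Finset.sum_range_succ]; linarith [hCn N]
    have h3 : ∑ k ∈ Finset.range N, C (k + 1) ≤ SC := by
      rw [hSC, Finset.sum_range_succ']; linarith [hCn 0]
    have h4 : ∑ k ∈ Finset.range N, w k ≤ Sw := by
      rw [hSw, Finset.sum_range_succ]; linarith [hwn N]
    have h5 := mul_le_mul_of_nonneg_left h4 (show 0 ≤ 3 * (n : ℝ) * α ^ 2 by positivity)
    linarith
  -- estimator error
  have hSe := sum_le_of_reset (a := e) (q := q) (K := N + 1)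
    (d := fun k => L ^ 2 / B * ((1 / (n : ℝ)) ^ 2 * δ k)) hen
    (fun k => by have := hδn k; positivity) he0 he (Nat.lt_succ_self N)
  rw [← Finset.mul_sum, ← Finset.mul_sum, ← hZ] at hSe
  -- descent
  have hSF : ∀ M : ℕ, F M ≤ F 0 - α / 2 * ∑ k ∈ Finset.range M, G k
      - α / 2 * (1 - L * α) * ∑ k ∈ Finset.range M, w k + α * ∑ k ∈ Finset.range M, e k
      + α * (L ^ 2 / n * ∑ k ∈ Finset.range M, C k) := by
    intro M
    induction M with
    | zero => simp
    | succ M ih =>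
      simp only [Finset.sum_range_succ]
      linarith [hF M]
  have hSF' := (hFs _).trans (hSF (N + 1))
  rw [← hSG, ← hSw, ← hSC] at hSF'
  -- Scaling consensus and displacement sums by `L ^ 2 / n` leaves `q / (n * B)` as the variance
  -- factor.
  refine resolve_coupled_bounds (b := b) (c₂ := c₂) (u := α * L) (g := g)
    (ρ := (q : ℝ) / (n * B)) (ζ := L ^ 2 / n * Z) (w := Sw)
    (s := ∑ k ∈ Finset.range (N + 1), e k) hb hb0 hc₂ (by positivity) hg (by linarith) hu1
    (by positivity) hu2 hu3 (by positivity) hSw0 hG₀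
    (mul_nonneg hL.le (sub_nonneg.2 (hFs 0))) ?_ ?_ ?_ ?_
  · calc L ^ 2 / n * SC
        ≤ L ^ 2 / n * (2 * α ^ 2 / g ^ 3 * (n * G₀) + 16 * α ^ 2 * L ^ 2 / g ^ 4 * Z) :=
          mul_le_mul_of_nonneg_left hSC2 (by positivity)
      _ = _ := by field_simp
  · calc L ^ 2 / n * Z ≤ L ^ 2 / n * (6 * SC + 3 * n * α ^ 2 * Sw) :=
          mul_le_mul_of_nonneg_left hZ1 (by positivity)
      _ = _ := by field_simp
  · refine hSe.trans (le_of_eq ?_)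
    ring
  · have h1 : 2 * (L * (F 0 - Fs) / (α * L)) = 2 / α * (F 0 - Fs) := by field_simp
    rw [h1]
    have h2 := mul_le_mul_of_nonneg_left hSF' (show 0 ≤ 2 / α by positivity)
    have h3 : 2 / α * (F 0 - α / 2 * SG - α / 2 * (1 - L * α) * Sw
        + α * ∑ k ∈ Finset.range (N + 1), e k + α * (L ^ 2 / n * SC))
        = 2 / α * F 0 - SG - (1 - L * α) * Sw + 2 * ∑ k ∈ Finset.range (N + 1), e k
          + 2 * (L ^ 2 / n * SC) := by field_simp
    rw [h3] at h2
    linarith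

lemma expect_monotone {β : Type*} [Fintype β] {g h : β → ℝ} (hgh : ∀ x, g x ≤ h x) :
    𝔼 x, g x ≤ 𝔼 x, h x := Finset.expect_le_expect fun x _ => hgh x

variable {n m p B q : ℕ} {f : Fin n → Fin m → Vec p → ℝ} {W : Matrix (Fin n) (Fin n) ℝ}
  {L α : ℝ} {x₀ : Vec p}

/-- The bound on the summed expected gaps, for the expectation as a finite uniform average. -/
theorem sum_expect_gap_le {b c₂ : ℝ} (hn : 1 ≤ n) (hB : 1 ≤ B)
    (hf : SmoothCosts f L) (hW : NetworkWeights W) (hα : 0 < α)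
    (hb : b * (14 * (1 + c₂)) = 1) (hb0 : 0 < b) (hc₂ : 0 < c₂)
    (hu1 : α * L ≤ b * (1 - netLambda W) ^ 2)
    (hu2 : (q : ℝ) / (n * B) * (α * L) ^ 2 ≤ c₂ * b ^ 2)
    (hu3 : (q : ℝ) / (n * B) * (α * L) ^ 3 ≤ c₂ * b ^ 3 * (1 - netLambda W) ^ 3)
    (j₀ : Fin m) (N : ℕ) :
    ∑ k ∈ Finset.range (N + 1), 𝔼 σ : SampleIndex n B q (N + 1) → Fin m,
        (1 / (n : ℝ)) * ∑ i, gap f L (flatState f W α q x₀ (sampler j₀ σ) k).x i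
      ≤ 5 * (initialGap f L x₀ / (α * L)) := by
  have : NeZero m := ⟨by have := j₀.2; omega⟩
  have hn' : (0 : ℝ) < n := by exact_mod_cast hn
  have hds := hW.doublyStochastic
  have hL := hf.L_pos
  let T := SampleIndex n B q (N + 1) → Fin m
  let z : T → ℕ → State n p := fun σ => flatState f W α q x₀ (sampler j₀ σ)
  have hz0 : ∀ σ, (z σ 0).x = fun _ => x₀ := fun _ => rfl
  have main := sum_le_of_recursions (n := n) (q := q) (B := B) (N := N)
    (C := fun k => 𝔼 σ : T, disagreement (z σ k).x)
    (D := fun k => 𝔼 σ : T, disagreement (z σ k).y)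
    (U := fun k => 𝔼 σ : T, ∑ i, ‖(z σ (k + 1)).v i - (z σ k).v i‖ ^ 2)
    (δ := fun k => 𝔼 σ : T, ∑ i, ‖(z σ (k + 1)).x i - (z σ k).x i‖ ^ 2)
    (e := fun k => 𝔼 σ : T, ‖nodeMean (estimatorError f W α q x₀ (sampler j₀ σ) k)‖ ^ 2)
    (e' := fun k => 𝔼 σ : T, ∑ i, ‖estimatorError f W α q x₀ (sampler j₀ σ) k i‖ ^ 2)
    (G := fun k => 𝔼 σ : T, ‖gradient (globalCost f) (nodeMean (z σ k).x)‖ ^ 2)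
    (w := fun k => 𝔼 σ : T, ‖nodeMean (z σ (k + 1)).v‖ ^ 2)
    (F := fun k => 𝔼 σ : T, globalCost f (nodeMean (z σ k).x))
    (G₀ := (1 / (n : ℝ)) * ∑ i, ‖gradient (localCost f i) x₀‖ ^ 2)
    (Fs := ⨅ x, globalCost f x)
    hn hL hα (netLambda_nonneg W) (netLambda_lt_one hn hW) hb hb0 hc₂ hu1 hu2 hu3
    (fun k => Finset.expect_nonneg fun σ _ => disagreement_nonneg _)
    (fun k => Finset.expect_nonneg fun σ _ => disagreement_nonneg _)
    (fun k => Finset.expect_nonneg fun σ _ => Finset.sum_nonneg fun i _ => sq_nonneg _)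
    (fun k => Finset.expect_nonneg fun σ _ => sq_nonneg _)
    (fun k => Finset.expect_nonneg fun σ _ => Finset.sum_nonneg fun i _ => sq_nonneg _)
    (fun k => Finset.expect_nonneg fun σ _ => sq_nonneg _)
    (by positivity)
    (by simp only [hz0, disagreement_const hn, Fintype.expect_const])
    (fun k => by
      simp only [Finset.mul_expect, ← Finset.expect_add_distrib]
      exact expect_monotone fun σ => disagreement_x_succ_le f W α q x₀ _ hn hW k)
    (by
      rw [← mul_assoc, mul_one_div_cancel hn'.ne', one_mul]
      refine (expect_monotone fun σ => disagreement_y_one_le hf hn).trans_eq ?_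
      rw [Fintype.expect_const])
    (fun k => by
      simp only [Finset.mul_expect, ← Finset.expect_add_distrib]
      exact expect_monotone fun σ => disagreement_y_succ_le f W α q x₀ _ hn hW k)
    (fun k hk hr => by
      simp only [Finset.expect_sum_comm, Finset.mul_sum]
      exact Finset.sum_le_sum fun i _ => expect_norm_v_succ_sub_sq_le hf hk hr i)
    (fun k hr => by
      simp only [Finset.mul_expect, ← Finset.expect_add_distrib]
      refine expect_monotone fun σ => ?_
      simp only [Finset.mul_sum, ← Finset.sum_add_distrib]
      refine Finset.sum_le_sum fun i _ => ?_
      -- At a batch step the new estimator is exact, so its change is a true gradient increment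
      -- minus the error just discarded.
      have h1 := norm_add_sq_le_of_pos one_pos
        (gradient (localCost f i) ((z σ (k + 1)).x i) - gradient (localCost f i) ((z σ k).x i))
        (-estimatorError f W α q x₀ (sampler j₀ σ) k i)
      have h2 := hf.norm_gradient_localCost_sub_sq_le i ((z σ (k + 1)).x i) ((z σ k).x i)
      have h3 : (z σ (k + 1 + 1)).v i - (z σ (k + 1)).v i
          = gradient (localCost f i) ((z σ (k + 1)).x i)
            - gradient (localCost f i) ((z σ k).x i)
            + -estimatorError f W α q x₀ (sampler j₀ σ) k i := by
        rw [estimatorError, flatState_succ_v_of_mod_eq_zero hf hr]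
        abel
      rw [norm_neg, ← h3] at h1
      linarith)
    (fun k hr => Finset.expect_eq_zero fun σ _ => by
      simp [nodeMean, estimatorError_of_mod_eq_zero hf hr])
    (fun k hk hr => by
      -- Equal weights `1/n` give the error of the mean, and their squares produce the gain from
      -- averaging over the nodes.
      have h := expect_norm_sum_estimatorError_sq_le (W := W) (α := α) (x₀ := x₀) (j₀ := j₀)
        hf hB (fun _ : Fin n => 1 / (n : ℝ)) hk hr
      simpa only [nodeMean, Finset.smul_sum, Finset.expect_sum_comm, Finset.mul_sum] using h)
    (fun k hr => Finset.expect_eq_zero fun σ _ => by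
      simp [estimatorError_of_mod_eq_zero hf hr])
    (fun k hk hr => by
      simp only [Finset.expect_sum_comm, Finset.mul_sum, ← Finset.sum_add_distrib]
      refine Finset.sum_le_sum fun i _ => ?_
      -- Indicator weights isolate a single node; the factor `1/B` is not needed here and is
      -- dropped.
      have h := expect_norm_sum_estimatorError_sq_le (W := W) (α := α) (x₀ := x₀) (j₀ := j₀)
        hf hB (fun i' : Fin n => if i' = i then 1 else 0) hk hr
      simp only [ite_smul, one_smul, zero_smul, Finset.sum_ite_eq', Finset.mem_univ, if_true,
        ite_pow, one_pow, zero_pow two_ne_zero, ite_mul, one_mul, zero_mul] at h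
      refine h.trans (add_le_add_right (mul_le_mul_of_nonneg_right
        (div_le_self (sq_nonneg L) (by exact_mod_cast hB)) ?_) _)
      exact Finset.expect_nonneg fun σ _ => sq_nonneg _)
    (fun k => by
      simp only [Finset.mul_expect, ← Finset.expect_add_distrib]
      exact expect_monotone fun σ => sum_norm_x_succ_sub_sq_le f W α q x₀ _ hds k)
    (fun k => by
      simp only [Finset.mul_expect, ← Finset.expect_add_distrib, ← Finset.expect_sub_distrib]
      exact expect_monotone fun σ => globalCost_nodeMean_succ_le W α q x₀ _ hf hn hds hα.le k)
    (fun k => by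
      rw [← Fintype.expect_const (ι := T) (⨅ x, globalCost f x)]
      exact expect_monotone fun σ => hf.iInf_le _)
  have hF0 : 𝔼 σ : T, globalCost f (nodeMean (z σ 0).x) = globalCost f x₀ := by
    simp only [hz0, nodeMean_const hn, Fintype.expect_const]
  simp only [hF0] at main
  rw [initialGap]
  refine le_trans ?_ main
  rw [Finset.mul_sum, Finset.mul_sum, Finset.mul_sum, ← Finset.sum_add_distrib]
  refine Finset.sum_le_sum fun k _ => ?_
  simp only [Finset.mul_expect, ← Finset.expect_add_distrib]
  exact expect_monotone fun σ => hf.gap_le hn _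

end Convergence

/-! ### From the probability space to finite uniform averages. -/

section Sampling

open scoped BigOperators

variable {n m p B q K : ℕ} {Ω : Type*} {τ : ℕ → ℕ → Fin n → Fin B → Ω → Fin m}

/-- The sampled coordinates among the first `K` steps, as a random element of a finite set. -/
def sampleVector (q K : ℕ) (τ : ℕ → ℕ → Fin n → Fin B → Ω → Fin m) (ω : Ω)
    (κ : SampleIndex n B q K) : Fin m :=
  τ ((κ.1.1 : ℕ) / (q + 1)) ((κ.1.1 : ℕ) % (q + 1)) κ.2.1 κ.2.2 ω

lemma SampleIndex.mod_mem (κ : SampleIndex n B q K) :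
    1 ≤ (κ.1.1 : ℕ) % (q + 1) ∧ (κ.1.1 : ℕ) % (q + 1) ≤ q :=
  ⟨Nat.one_le_iff_ne_zero.2 κ.1.2, Nat.le_of_lt_succ (Nat.mod_lt _ (Nat.succ_pos q))⟩

lemma iterate_eq_flatState_sampler {f : Fin n → Fin m → Vec p → ℝ}
    {W : Matrix (Fin n) (Fin n) ℝ} {α : ℝ} {x₀ : Vec p} (j₀ : Fin m) (ω : Ω) {s t : ℕ}
    (ht : t ≤ q) (hK : s * (q + 1) + t ≤ K) :
    iterate f W α q x₀ (fun s t i l => τ s t i l ω) s t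
      = (flatState f W α q x₀ (sampler j₀ (sampleVector q K τ ω)) (s * (q + 1) + t)).x := by
  rw [iterate_eq_flatState _ _ _ _ _ _ _ ht]
  congr 1
  refine flatState_congr fun k hk hr => ?_
  funext i l
  rw [sampler_of_lt _ (by omega) hr]
  rfl

variable [MeasurableSpace Ω] {P : Measure Ω}

lemma measurable_sampleVector_apply (hτ : UniformSampling P q τ) (κ : SampleIndex n B q K) :
    Measurable fun ω => sampleVector q K τ ω κ :=
  hτ.measurable _ _ _ _ κ.mod_mem.1 κ.mod_mem.2

lemma measurable_sampleVector (hτ : UniformSampling P q τ) :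
    Measurable (sampleVector q K τ) :=
  measurable_pi_lambda _ fun κ => measurable_sampleVector_apply hτ κ

lemma iIndepFun_sampleVector (hτ : UniformSampling P q τ) :
    iIndepFun (fun (κ : SampleIndex n B q K) ω => sampleVector q K τ ω κ) P := by
  -- The independent family indexes inner step `t` by `t - 1` in `Fin q`; quotient and remainder
  -- recover the time, so the reindexing is injective.
  let φ : SampleIndex n B q K → ℕ × Fin q × Fin n × Fin B := fun κ =>
    ((κ.1.1 : ℕ) / (q + 1), ⟨(κ.1.1 : ℕ) % (q + 1) - 1, by have := κ.mod_mem; omega⟩, κ.2)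
  have hφ : Function.Injective φ := by
    rintro κ κ' h
    simp only [φ, Prod.mk.injEq, Fin.mk.injEq] at h
    have h1 := κ.mod_mem
    have h2 := κ'.mod_mem
    have h3 := Nat.div_add_mod (κ.1.1 : ℕ) (q + 1)
    have h4 := Nat.div_add_mod (κ'.1.1 : ℕ) (q + 1)
    have h5 : (κ.1.1 : ℕ) % (q + 1) = (κ'.1.1 : ℕ) % (q + 1) := by omega
    rw [h.1, h5, h4] at h3
    exact Prod.ext (Subtype.ext (Fin.ext h3.symm)) h.2.2
  convert hτ.indep.precomp hφ using 2 with κ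
  funext ω
  have h1 := κ.mod_mem
  have h2 : (κ.1.1 : ℕ) % (q + 1) - 1 + 1 = (κ.1.1 : ℕ) % (q + 1) := by omega
  simp only [sampleVector, φ, h2]

variable [IsProbabilityMeasure P]

lemma integrable_comp_sampleVector (hτ : UniformSampling P q τ)
    (g : (SampleIndex n B q K → Fin m) → ℝ) : Integrable (fun ω => g (sampleVector q K τ ω)) P :=
  have := Measure.isProbabilityMeasure_map (μ := P) (measurable_sampleVector (K := K) hτ).aemeasurable
  (Integrable.of_finite (μ := P.map (sampleVector q K τ)) (f := g)).comp_measurable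
    (measurable_sampleVector hτ)

/-- Independence makes the law of the sample vector a product of uniform laws, which gives every
point the same mass. -/
lemma integral_comp_sampleVector (hτ : UniformSampling P q τ)
    (g : (SampleIndex n B q K → Fin m) → ℝ) :
    ∫ ω, g (sampleVector q K τ ω) ∂P = 𝔼 σ, g σ := by
  have hmeas := measurable_sampleVector (K := K) hτ
  have := Measure.isProbabilityMeasure_map (μ := P) hmeas.aemeasurable
  have hlaw : ∀ σ : SampleIndex n B q K → Fin m, (P.map (sampleVector q K τ)).real {σ}
      = ((Fintype.card (SampleIndex n B q K → Fin m) : ℕ) : ℝ)⁻¹ := by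
    intro σ
    have h1 := (iIndepFun_iff_map_fun_eq_pi_map
      fun κ => (measurable_sampleVector_apply hτ κ).aemeasurable).1
      (iIndepFun_sampleVector (K := K) hτ)
    have h2 : P.map (sampleVector q K τ) = Measure.pi fun κ => P.map fun ω =>
        sampleVector q K τ ω κ := h1
    rw [Measure.real, h2, Measure.pi_singleton]
    have h3 : ∀ κ : SampleIndex n B q K, (P.map fun ω => sampleVector q K τ ω κ) {σ κ}
        = (m : ENNReal)⁻¹ := by
      intro κ
      rw [Measure.map_apply (measurable_sampleVector_apply hτ κ) (measurableSet_singleton _)]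
      exact hτ.uniform _ _ _ _ κ.mod_mem.1 κ.mod_mem.2 _
    simp only [h3, Finset.prod_const, Finset.card_univ, Fintype.card_fun, Fintype.card_fin,
      ENNReal.toReal_pow, ENNReal.toReal_inv, ENNReal.toReal_natCast, inv_pow, Nat.cast_pow]
  rw [← integral_map hmeas.aemeasurable (Integrable.of_finite (μ := P.map
    (sampleVector q K τ)) (f := g)).aestronglyMeasurable, integral_fintype Integrable.of_finite]
  simp only [hlaw, smul_eq_mul, ← Finset.mul_sum]
  rw [Fintype.expect_eq_sum_div_card, div_eq_inv_mul]

lemma sum_range_mul_eq (a : ℕ → ℝ) (S r : ℕ) :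
    ∑ s ∈ Finset.range S, ∑ t ∈ Finset.range r, a (s * r + t) = ∑ k ∈ Finset.range (S * r), a k := by
  induction S with
  | zero => simp
  | succ S ih => rw [Finset.sum_range_succ, ih, Nat.succ_mul, Finset.sum_range_add]

/-- The algorithm finds an accurate stationary point as soon as the number of steps exceeds the
bound on the summed expected gaps. -/
theorem findsStationary_of_le {f : Fin n → Fin m → Vec p → ℝ} {W : Matrix (Fin n) (Fin n) ℝ}
    {L α ε : ℝ} {x₀ : Vec p} {b c₂ : ℝ} (hn : 1 ≤ n) (hB : 1 ≤ B) (hm : 1 ≤ m)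
    (hf : SmoothCosts f L) (hW : NetworkWeights W) (hτ : UniformSampling P q τ) (hα : 0 < α)
    (hb : b * (14 * (1 + c₂)) = 1) (hb0 : 0 < b) (hc₂ : 0 < c₂)
    (hu1 : α * L ≤ b * (1 - netLambda W) ^ 2)
    (hu2 : (q : ℝ) / (n * B) * (α * L) ^ 2 ≤ c₂ * b ^ 2)
    (hu3 : (q : ℝ) / (n * B) * (α * L) ^ 3 ≤ c₂ * b ^ 3 * (1 - netLambda W) ^ 3)
    {S : ℕ} (hS : 1 ≤ S) (hSε : 5 * (initialGap f L x₀ / (α * L)) ≤ ε ^ 2 * (S * (q + 1))) :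
    FindsStationary P f W L α q x₀ τ S ε := by
  obtain ⟨N, hN⟩ : ∃ N, S * (q + 1) = N + 1 :=
    Nat.exists_eq_succ_of_ne_zero (Nat.mul_ne_zero (by omega) (by omega))
  let j₀ : Fin m := ⟨0, hm⟩
  have hle : ∀ s t, s < S → t ≤ q → s * (q + 1) + t ≤ N + 1 := by
    intro s t hs ht
    have : (s + 1) * (q + 1) ≤ S * (q + 1) := Nat.mul_le_mul_right _ hs
    rw [Nat.succ_mul] at this
    omega
  have hgap : ∀ s t i, s < S → t ≤ q →
      (fun ω => gap f L (iterate f W α q x₀ (fun s t i l => τ s t i l ω) s t) i)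
        = fun ω => (fun σ => gap f L
          (flatState f W α q x₀ (sampler j₀ σ) (s * (q + 1) + t)).x i)
          (sampleVector q (N + 1) τ ω) := by
    intro s t i hs ht
    funext ω
    rw [iterate_eq_flatState_sampler j₀ ω ht (hle s t hs ht)]
  refine ⟨hS, fun s t i hs ht => ?_, ?_⟩
  · have h := hgap s t i hs ht
    change Integrable (fun ω => gap f L (iterate f W α q x₀ (fun s t i l => τ s t i l ω) s t) i) P
    rw [h]
    exact integrable_comp_sampleVector (K := N + 1) hτ (fun σ => gap f L
      (flatState f W α q x₀ (sampler j₀ σ) (s * (q + 1) + t)).x i)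
  · have hsum : ∑ s ∈ Finset.range S, ∑ t ∈ Finset.range (q + 1), (1 / (n : ℝ)) * ∑ i,
        ∫ ω, gap f L (iterate f W α q x₀ (fun s t i l => τ s t i l ω) s t) i ∂P
        = ∑ k ∈ Finset.range (N + 1), 𝔼 σ : SampleIndex n B q (N + 1) → Fin m,
          (1 / (n : ℝ)) * ∑ i, gap f L (flatState f W α q x₀ (sampler j₀ σ) k).x i := by
      rw [← hN, ← sum_range_mul_eq]
      refine Finset.sum_congr rfl fun s hs => Finset.sum_congr rfl fun t ht => ?_
      rw [← Finset.mul_expect, Finset.expect_sum_comm, hN]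
      congr 1
      refine Finset.sum_congr rfl fun i _ => ?_
      rw [hgap s t i (Finset.mem_range.1 hs) (Nat.le_of_lt_succ (Finset.mem_range.1 ht))]
      exact integral_comp_sampleVector (K := N + 1) hτ (fun σ => gap f L
      (flatState f W α q x₀ (sampler j₀ σ) (s * (q + 1) + t)).x i)
    have hmain := sum_expect_gap_le (x₀ := x₀) hn hB hf hW hα hb hb0 hc₂ hu1 hu2 hu3 j₀ N
    rw [← hsum] at hmain
    have hpos : (0 : ℝ) < S * ((q : ℝ) + 1) := by positivity
    rw [one_div, inv_mul_le_iff₀ hpos]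
    linarith

end Sampling

/-! ### Step-size conditions and complexity counts. -/

section Rates

variable {n m p B q : ℕ}

lemma rpow_half_sq (k : ℕ) : ((k : ℝ) ^ (1 / 2 : ℝ)) ^ 2 = k := by
  rw [← Real.rpow_natCast, ← Real.rpow_mul (Nat.cast_nonneg k)]
  norm_num

lemma rpow_third_cube (k : ℕ) : ((k : ℝ) ^ (1 / 3 : ℝ)) ^ 3 = k := by
  rw [← Real.rpow_natCast, ← Real.rpow_mul (Nat.cast_nonneg k)]
  norm_num

lemma rpow_two_thirds (k : ℕ) : (k : ℝ) ^ (2 / 3 : ℝ) = ((k : ℝ) ^ (1 / 3 : ℝ)) ^ 2 := by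
  rw [← Real.rpow_natCast, ← Real.rpow_mul (Nat.cast_nonneg k)]
  norm_num

/-- The two rates agree term by term up to `nB`, so only the number of rounds has to be estimated.
-/
lemma gradientRate_eq (hn : 1 ≤ n) (hm : 1 ≤ m) (hB : 1 ≤ B) {lam : ℝ} (hlam : lam < 1)
    (Δ ε : ℝ) : gradientRate n m B lam Δ ε = n * B * roundRate n m B lam Δ ε := by
  have hg : 0 < 1 - lam := by linarith
  have hn0 : (0 : ℝ) < n := by exact_mod_cast hn
  have hm0 : (0 : ℝ) < m := by exact_mod_cast hm
  have hB0 : (0 : ℝ) < B := by exact_mod_cast hB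
  unfold gradientRate roundRate
  rw [← mul_assoc, mul_max_of_nonneg _ _ (by positivity), mul_max_of_nonneg _ _ (by positivity),
    rpow_two_thirds, rpow_two_thirds, Real.mul_rpow hn0.le hm0.le]
  have h1 := rpow_half_sq n
  have h2 := rpow_third_cube n
  have h3 := rpow_third_cube B
  have h4 : (0 : ℝ) < (n : ℝ) ^ (1 / 2 : ℝ) := by positivity
  have h5 : (0 : ℝ) < (n : ℝ) ^ (1 / 3 : ℝ) := by positivity
  have h6 : (0 : ℝ) < (B : ℝ) ^ (1 / 3 : ℝ) := by positivity
  generalize (n : ℝ) ^ (1 / 2 : ℝ) = sn at *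
  generalize (n : ℝ) ^ (1 / 3 : ℝ) = cn at *
  generalize (B : ℝ) ^ (1 / 3 : ℝ) = cB at *
  congr 2
  · ring
  · congr 1
    · rw [← h1]; field_simp
    · rw [← h2, ← h3]; field_simp

lemma one_le_min_mul_max_inv {x y z : ℝ} (hx : 0 < x) (hy : 0 < y) (hz : 0 < z) :
    1 ≤ min x (min y z) * max (1 / x) (max (1 / y) (1 / z)) := by
  have key : ∀ {t R : ℝ}, 0 < t → 1 / t ≤ R → 1 ≤ t * R := fun ht hR => by
    rwa [div_le_iff₀' ht] at hR
  rcases min_choice x (min y z) with h | h <;> rw [h]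
  · exact key hx (le_max_left _ _)
  · rcases min_choice y z with h | h <;> rw [h]
    · exact key hy ((le_max_left _ _).trans (le_max_right _ _))
    · exact key hz ((le_max_right _ _).trans (le_max_right _ _))

lemma stepScale_pos (hn : 1 ≤ n) (hm : 1 ≤ m) (hB : 1 ≤ B) {lam L : ℝ} (hlam : lam < 1)
    (hL : 0 < L) : 0 < stepScale n m B lam L := by
  have hg : 0 < 1 - lam := by linarith
  unfold stepScale
  refine div_pos (lt_min (by positivity) (lt_min (by positivity) (by positivity))) hL

/-- The rate is at least the reciprocal of the scaled step size. -/
lemma div_stepScale_le_roundRate (hn : 1 ≤ n) (hm : 1 ≤ m) (hB : 1 ≤ B) {lam L a α Δ ε : ℝ}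
    (hlam : lam < 1) (hL : 0 < L) (ha : 0 < a) (hα : a * stepScale n m B lam L ≤ α)
    (hΔ : 0 ≤ Δ) : Δ / (α * L) / ε ^ 2 ≤ 1 / a * roundRate n m B lam Δ ε := by
  have hg : 0 < 1 - lam := by linarith
  have hM := stepScale_pos hn hm hB hlam hL
  have hα0 : 0 < α := (mul_pos ha hM).trans_le hα
  set R := max (1 / (1 - lam) ^ 2)
    (max ((m : ℝ) ^ (1 / 2 : ℝ) / ((n : ℝ) ^ (1 / 2 : ℝ) * B))
      ((m : ℝ) ^ (1 / 3 : ℝ) / ((n : ℝ) ^ (1 / 3 : ℝ) * (B : ℝ) ^ (2 / 3 : ℝ) * (1 - lam)))) with hR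
  have h1 : 1 ≤ stepScale n m B lam L * L * R := by
    have := one_le_min_mul_max_inv (x := (1 - lam) ^ 2)
      (y := (n : ℝ) ^ (1 / 2 : ℝ) * B / (m : ℝ) ^ (1 / 2 : ℝ))
      (z := (n : ℝ) ^ (1 / 3 : ℝ) * (B : ℝ) ^ (2 / 3 : ℝ) * (1 - lam) / (m : ℝ) ^ (1 / 3 : ℝ))
      (by positivity) (by positivity) (by positivity)
    rwa [one_div_div, one_div_div, ← hR, ← div_mul_cancel₀ (min _ _) hL.ne'] at this
  have hR0 : 0 ≤ R := (by positivity : (0 : ℝ) ≤ 1 / (1 - lam) ^ 2).trans (le_max_left _ _)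
  have h2 : 1 / (α * L) ≤ 1 / a * R := by
    rw [div_le_iff₀ (by positivity)]
    calc (1 : ℝ) ≤ stepScale n m B lam L * L * R := h1
      _ = 1 / a * R * (a * stepScale n m B lam L * L) := by field_simp
      _ ≤ 1 / a * R * (α * L) := by gcongr
  calc Δ / (α * L) / ε ^ 2 = 1 / (α * L) * (Δ / ε ^ 2) := by ring
    _ ≤ 1 / a * R * (Δ / ε ^ 2) := mul_le_mul_of_nonneg_right h2 (by positivity)
    _ = 1 / a * roundRate n m B lam Δ ε := by rw [roundRate, ← hR]; ring

/-- The step-size conditions of the convergence bound. -/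
lemma stepSize_conditions (hn : 1 ≤ n) (hm : 1 ≤ m) (hB : 1 ≤ B) {lam L b α c₂ : ℝ}
    (hlam : lam < 1) (hL : 0 < L) (hb : 0 < b) (hα0 : 0 < α)
    (hα : α ≤ b * stepScale n m B lam L) (hc₂ : 0 < c₂) (hq : (q : ℝ) ≤ c₂ * ((m : ℝ) / B)) :
    α * L ≤ b * (1 - lam) ^ 2 ∧ (q : ℝ) / (n * B) * (α * L) ^ 2 ≤ c₂ * b ^ 2 ∧
      (q : ℝ) / (n * B) * (α * L) ^ 3 ≤ c₂ * b ^ 3 * (1 - lam) ^ 3 := by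
  have hg : 0 < 1 - lam := by linarith
  have hn0 : (0 : ℝ) < n := by exact_mod_cast hn
  have hm0 : (0 : ℝ) < m := by exact_mod_cast hm
  have hB0 : (0 : ℝ) < B := by exact_mod_cast hB
  have hu : α * L ≤ b * min ((1 - lam) ^ 2)
      (min ((n : ℝ) ^ (1 / 2 : ℝ) * B / (m : ℝ) ^ (1 / 2 : ℝ))
      ((n : ℝ) ^ (1 / 3 : ℝ) * (B : ℝ) ^ (2 / 3 : ℝ) * (1 - lam) / (m : ℝ) ^ (1 / 3 : ℝ))) := by
    refine (mul_le_mul_of_nonneg_right hα hL.le).trans_eq ?_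
    rw [stepScale, mul_assoc, div_mul_cancel₀ _ hL.ne']
  have hu0 : 0 ≤ α * L := by positivity
  -- The factor `m / (n * B ^ 2)` is the inverse of what the second and third terms of `stepScale`
  -- yield when squared and cubed, apart from `(1 - lam) ^ 3` in the cubic case.
  have hρ : (q : ℝ) / (n * B) ≤ c₂ * (m / (n * B ^ 2)) := by
    rw [div_le_iff₀ (by positivity)]
    refine hq.trans_eq ?_
    field_simp
  refine ⟨hu.trans (mul_le_mul_of_nonneg_left (min_le_left _ _) hb.le), ?_, ?_⟩
  · have h1 := hu.trans (mul_le_mul_of_nonneg_left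
      ((min_le_right _ _).trans (min_le_left _ _)) hb.le)
    have h2 := pow_le_pow_left₀ hu0 h1 2
    rw [mul_pow b, div_pow, mul_pow _ (B : ℝ), rpow_half_sq, rpow_half_sq] at h2
    calc (q : ℝ) / (n * B) * (α * L) ^ 2
        ≤ c₂ * (m / (n * B ^ 2)) * (b ^ 2 * (n * B ^ 2 / m)) := by gcongr
      _ = _ := by field_simp
  · have h1 := hu.trans (mul_le_mul_of_nonneg_left
      ((min_le_right _ _).trans (min_le_right _ _)) hb.le)
    have h2 := pow_le_pow_left₀ hu0 h1 3
    have h3 : (((B : ℝ) ^ (2 / 3 : ℝ)) ^ 3) = B ^ 2 := by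
      rw [rpow_two_thirds, ← pow_mul, mul_comm, pow_mul, rpow_third_cube]
    rw [mul_pow b, div_pow, mul_pow _ (1 - lam), mul_pow _ ((B : ℝ) ^ (2 / 3 : ℝ)),
      rpow_third_cube, rpow_third_cube, h3] at h2
    calc (q : ℝ) / (n * B) * (α * L) ^ 3
        ≤ c₂ * (m / (n * B ^ 2)) * (b ^ 3 * (n * B ^ 2 * (1 - lam) ^ 3 / m)) := by gcongr
      _ = _ := by field_simp

lemma totalRounds_eq (q S : ℕ) : (totalRounds q S : ℝ) = S * (q + 1) := by
  simp [totalRounds]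

lemma totalGradients_eq (n m B q S : ℕ) :
    (totalGradients n m B q S : ℝ) = S * (n * m + q * (n * (2 * B))) := by
  simp only [totalGradients, Finset.sum_range_succ', stepGradients, if_true,
    Nat.succ_ne_zero, if_false, Finset.sum_const, Finset.card_range, smul_eq_mul]
  push_cast
  ring

/-- The lower bound on `q` spreads the batch cost over the inner loop: `m` is at most `B q / c₁`. -/
lemma totalGradients_le_totalRounds {c₁ : ℝ} (hc₁ : 0 < c₁) (hB : 1 ≤ B)
    (hq : c₁ * ((m : ℝ) / B) ≤ q) (S : ℕ) :
    (totalGradients n m B q S : ℝ) ≤ (1 / c₁ + 2) * (n * B) * totalRounds q S := by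
  have hB0 : (0 : ℝ) < B := by exact_mod_cast hB
  rw [totalGradients_eq, totalRounds_eq]
  have h1 : (m : ℝ) ≤ 1 / c₁ * B * q := by
    calc (m : ℝ) = 1 / c₁ * B * (c₁ * (m / B)) := by field_simp
      _ ≤ _ := by gcongr
  calc (S : ℝ) * (n * m + q * (n * (2 * B)))
      ≤ S * (n * (1 / c₁ * B * q) + q * (n * (2 * B))) := by gcongr
    _ = (1 / c₁ + 2) * (n * B) * (S * q) := by ring
    _ ≤ (1 / c₁ + 2) * (n * B) * (S * (q + 1)) := by gcongr; linarith

lemma SmoothCosts.initialGap_nonneg {f : Fin n → Fin m → Vec p → ℝ} {L : ℝ}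
    (hf : SmoothCosts f L) (x₀ : Vec p) : 0 ≤ initialGap f L x₀ :=
  add_nonneg (mul_nonneg hf.L_pos.le (sub_nonneg.2 (hf.iInf_le x₀))) (by positivity)

end Rates

end GTSarah

end

open GTSarah in
theorem theorem3p5 (c₁ c₂ : ℝ) (hc₁ : 0 < c₁) (hc₂ : c₁ ≤ c₂) :
    ∃ b : ℝ, 0 < b ∧ ∀ a : ℝ, 0 < a → a ≤ b → ∃ C : ℝ, 0 < C ∧
      ∀ (n m p B q : ℕ) (f : Fin n → Fin m → Vec p → ℝ) (W : Matrix (Fin n) (Fin n) ℝ)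
        (x₀ : Vec p) (L α ε : ℝ)
        (Ω : Type*) [MeasurableSpace Ω] (P : MeasureTheory.Measure Ω)
        [MeasureTheory.IsProbabilityMeasure P]
        (τ : ℕ → ℕ → Fin n → Fin B → Ω → Fin m),
        1 ≤ n → 1 ≤ B → B ≤ m →
        SmoothCosts f L → NetworkWeights W → UniformSampling P q τ →
        c₁ * ((m : ℝ) / B) ≤ q → (q : ℝ) ≤ c₂ * ((m : ℝ) / B) →
        a * stepScale n m B (netLambda W) L ≤ α → α ≤ b * stepScale n m B (netLambda W) L →
        0 < ε →
        ∃ S : ℕ, FindsStationary P f W L α q x₀ τ S ε ∧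
          (totalGradients n m B q S : ℝ) ≤
            C * max ((n : ℝ) * m) (gradientRate n m B (netLambda W) (initialGap f L x₀) ε) ∧
          (totalRounds q S : ℝ) ≤
            C * max ((m : ℝ) / B) (roundRate n m B (netLambda W) (initialGap f L x₀) ε) ∧
          ((n : ℝ) * m ≤ gradientRate n m B (netLambda W) (initialGap f L x₀) ε →
            (totalGradients n m B q S : ℝ) ≤
              C * gradientRate n m B (netLambda W) (initialGap f L x₀) ε ∧
            (totalRounds q S : ℝ) ≤
              C * roundRate n m B (netLambda W) (initialGap f L x₀) ε) := by
  have hc₂0 : 0 < c₂ := hc₁.trans_le hc₂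
  -- This choice makes both `b` and `c₂ * b` at most `1/14`, enough to absorb the feedback terms.
  set b : ℝ := 1 / (14 * (1 + c₂)) with hb
  have hb0 : 0 < b := by positivity
  have hb1 : b * (14 * (1 + c₂)) = 1 := one_div_mul_cancel (by positivity)
  -- In the constant, `5 / a` counts the required steps and `c₂ + 1` pays for completing the last
  -- outer iteration, as `1 ≤ m / B`. The factor `1 / c₁ + 3` majorizes the gradients per round in
  -- units of `nB`.
  refine ⟨b, hb0, fun a ha _ => ⟨(1 / c₁ + 3) * (5 / a + c₂ + 1), by positivity, ?_⟩⟩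
  intro n m p B q f W x₀ L α ε Ω _ P _ τ hn hB hBm hf hW hτ hq1 hq2 hα1 hα2 hε
  have hm : 1 ≤ m := hB.trans hBm
  have hn0 : (0 : ℝ) < n := by exact_mod_cast hn
  have hm0 : (0 : ℝ) < m := by exact_mod_cast hm
  have hB0 : (0 : ℝ) < B := by exact_mod_cast hB
  have hlam := netLambda_lt_one hn hW
  have hL := hf.L_pos
  have hα0 : 0 < α := (mul_pos ha (stepScale_pos hn hm hB hlam hL)).trans_le hα1
  obtain ⟨hu1, hu2, hu3⟩ := stepSize_conditions hn hm hB hlam hL hb0 hα0 hα2 hc₂0 hq2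
  have hΔ := hf.initialGap_nonneg x₀
  set Δ := initialGap f L x₀ with hΔdef
  have hrate := div_stepScale_le_roundRate (ε := ε) hn hm hB hlam hL ha hα1 hΔ
  set R := roundRate n m B (netLambda W) Δ ε with hR
  have hH := gradientRate_eq hn hm hB hlam Δ ε
  rw [← hR] at hH
  set A := 5 * (Δ / (α * L)) / (ε ^ 2 * (q + 1)) with hA
  have hA0 : 0 ≤ A := by positivity
  -- Floor plus one rather than a ceiling, so that `S ≥ 1` also when `Δ = 0`.
  set S := ⌊A⌋₊ + 1 with hS
  have hS1 : A ≤ S := by rw [hS]; push_cast; exact (Nat.lt_floor_add_one A).le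
  have hS2 : (S : ℝ) ≤ A + 1 := by
    rw [hS]; push_cast; linarith [Nat.floor_le hA0]
  have hrounds : (totalRounds q S : ℝ) ≤ (5 / a + c₂ + 1) * max ((m : ℝ) / B) R := by
    rw [totalRounds_eq]
    have h1 : A * (q + 1) = 5 * (Δ / (α * L) / ε ^ 2) := by rw [hA]; field_simp
    have h2 : (1 : ℝ) ≤ (m : ℝ) / B := by
      rw [one_le_div hB0]; exact_mod_cast hBm
    have h3 : (S : ℝ) * (q + 1) ≤ (A + 1) * (q + 1) := by gcongr
    have h4 : 5 / a * R ≤ 5 / a * max ((m : ℝ) / B) R := by gcongr; exact le_max_right _ _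
    have h5 : (c₂ + 1) * ((m : ℝ) / B) ≤ (c₂ + 1) * max ((m : ℝ) / B) R := by
      gcongr; exact le_max_left _ _
    have h6 : 5 / a * R = 5 * (1 / a * R) := by ring
    linarith
  have hgrads : (totalGradients n m B q S : ℝ)
      ≤ (1 / c₁ + 3) * (5 / a + c₂ + 1)
        * max ((n : ℝ) * m) (gradientRate n m B (netLambda W) Δ ε) := by
    have h1 : max ((n : ℝ) * m) (gradientRate n m B (netLambda W) Δ ε)
        = n * B * max ((m : ℝ) / B) R := by
      rw [hH, mul_max_of_nonneg _ _ (by positivity)]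
      congr 1
      field_simp
    rw [h1]
    have h2 : 0 ≤ max ((m : ℝ) / B) R := le_max_of_le_left (by positivity)
    calc (totalGradients n m B q S : ℝ) ≤ (1 / c₁ + 2) * (n * B) * totalRounds q S :=
          totalGradients_le_totalRounds hc₁ hB hq1 S
      _ ≤ (1 / c₁ + 3) * (n * B) * ((5 / a + c₂ + 1) * max ((m : ℝ) / B) R) := by
          gcongr
          norm_num
      _ = _ := by ring
  have hrounds' : (totalRounds q S : ℝ)
      ≤ (1 / c₁ + 3) * (5 / a + c₂ + 1) * max ((m : ℝ) / B) R := by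
    refine hrounds.trans (mul_le_mul_of_nonneg_right (le_mul_of_one_le_left (by positivity) ?_)
      (le_max_of_le_left (by positivity)))
    have : 0 < 1 / c₁ := by positivity
    linarith
  refine ⟨S, findsStationary_of_le hn hB hm hf hW hτ hα0 hb1 hb0 hc₂0 hu1 hu2 hu3
    (Nat.le_add_left 1 _) ?_, hgrads, hrounds', fun hN => ⟨?_, ?_⟩⟩
  · rw [← hΔdef]
    have h1 : 5 * (Δ / (α * L)) = ε ^ 2 * (A * (q + 1)) := by rw [hA]; field_simp
    rw [h1]
    gcongr
  · rwa [max_eq_right hN] at hgrads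
  · have h1 : (m : ℝ) / B ≤ R := by
      rw [hH] at hN
      rw [div_le_iff₀ hB0]
      have h2 : (n : ℝ) * m ≤ n * (R * B) := by linarith
      exact le_of_mul_le_mul_left h2 hn0
    rwa [max_eq_right h1] at hrounds'
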